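/- Call a finite set $A\subseteq\mathbb{R}^d$ a set of Pareto optimal alternatives if there are no $x,y\in A$ with $x_i\le y_i$ for all $i$ and $x_j<y_j$ for some $j$. For nonempty $S\subseteq A$ let $$I_{DC}(S,A)=\max_{a\in A}\min_{s\in S}\sum_{i=1}^d\max(a_i-s_i,0)$$ be the directed coverage of $S$. \textsc{Directed Coverage Pareto Pruning} is the problem: given a finite set $A\subseteq\mathbb{R}^d$ of Pareto optimal alternatives (as a list of its points, in arbitrary order and without repetition) and an integer $1\le k\le|A|$, find a set $S\subseteq A$ with $|S|=k$ that minimizes $I_{DC}(S,A)$ among all $k$-element subsets of $A$. For at most two objectives ($d\le 2$), \textsc{Directed Coverage Pareto Pruning} can be solved in time $O(|A|\,k+|A|\log|A|)$. That is, there are a single program for the unit-cost real random access machine (exact real arithmetic and comparisons, index arithmetic and indirect addressing, one step per operation) and a constant $C$ such that, on every such input with $d\le 2$, the program halts after at most $C\,(|A|\,k+|A|\log|A|)$ steps and outputs a list of $k$ indices of points that form an optimal set $S$. -/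

import Mathlib

namespace ParetoPruning

/-! ### Alternatives, slates, directed coverage -/

/-- `x` is dominated by `y` (all objectives are maximized). -/
def DominatedBy {d : ℕ} (x y : Fin d → ℝ) : Prop :=
  (∀ i, x i ≤ y i) ∧ ∃ j, x j < y j

/-- `A` consists of Pareto optimal points only: no member of `A` is dominated by a member of `A`.
These are exactly the finite sets that arise as the Pareto optimal value vectors of some
multiobjective optimization problem with finitely many alternatives. -/
def IsParetoSet {d : ℕ} (A : Finset (Fin d → ℝ)) : Prop :=
  ∀ x ∈ A, ∀ y ∈ A, ¬ DominatedBy x y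

/-- The directed Manhattan distance `‖a - s‖₊ = ∑ i, max (a i - s i) 0`. -/
noncomputable def directedDist {d : ℕ} (a s : Fin d → ℝ) : ℝ :=
  ∑ i, max (a i - s i) 0

/-- Directed coverage `max_{a ∈ A} min_{s ∈ S} ‖a - s‖₊` of a slate `S` with respect to `A`
(used for nonempty finite `S` and `A` only, where supremum and infimum are attained). -/
noncomputable def directedCoverage {d : ℕ} (S A : Finset (Fin d → ℝ)) : ℝ :=
  ⨆ a : A, ⨅ s : S, directedDist (a : Fin d → ℝ) (s : Fin d → ℝ)

/-- `S` is a size-`k` subset of `A` of minimum directed coverage. -/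
def IsOptimalSlate {d : ℕ} (A : Finset (Fin d → ℝ)) (k : ℕ) (S : Finset (Fin d → ℝ)) : Prop :=
  S ⊆ A ∧ S.card = k ∧
    ∀ S' : Finset (Fin d → ℝ), S' ⊆ A → S'.card = k →
      directedCoverage S A ≤ directedCoverage S' A

/-! ### A unit-cost real random access machine

Programs are while-programs over a random access memory.  There are index cells (holding natural
numbers, which may serve as addresses) and real cells (holding exact real numbers).  A program is a
fixed finite object, so it mentions finitely many registers and arrays; arrays are unbounded and are
addressed by computed indices (indirect addressing).  The operations are addition and truncated
subtraction of indices, addition, subtraction and multiplication of reals, and comparisons.  There is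
no conversion of reals to indices (no rounding), no multiplication of indices, and the only real
constants are rational.  Every operation, memory access, test and assignment costs one step. -/

/-- Memory: index registers, real registers, index arrays and real arrays. -/
structure Store where
  natReg : ℕ → ℕ
  realReg : ℕ → ℝ
  natArr : ℕ → ℕ → ℕ
  realArr : ℕ → ℕ → ℝ

/-- Index-valued expressions. -/
inductive NatExpr where
  | const (c : ℕ)
  | reg (x : ℕ)
  | get (arr : ℕ) (i : NatExpr)
  | add (e₁ e₂ : NatExpr)
  | sub (e₁ e₂ : NatExpr)

/-- Real-valued expressions. -/
inductive RealExpr where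
  | const (q : ℚ)
  | reg (x : ℕ)
  | get (arr : ℕ) (i : NatExpr)
  | add (e₁ e₂ : RealExpr)
  | sub (e₁ e₂ : RealExpr)
  | mul (e₁ e₂ : RealExpr)

/-- Tests. -/
inductive Test where
  | natLe (e₁ e₂ : NatExpr)
  | realLe (e₁ e₂ : RealExpr)
  | not (b : Test)
  | and (b₁ b₂ : Test)

/-- Programs. -/
inductive Prog where
  | skip
  | setNat (x : ℕ) (e : NatExpr)
  | setReal (x : ℕ) (e : RealExpr)
  | putNat (arr : ℕ) (i e : NatExpr)
  | putReal (arr : ℕ) (i : NatExpr) (e : RealExpr)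
  | seq (p q : Prog)
  | ite (b : Test) (p q : Prog)
  | while (b : Test) (p : Prog)

/-- Value of an index expression. -/
def NatExpr.eval (σ : Store) : NatExpr → ℕ
  | const c => c
  | reg x => σ.natReg x
  | get arr i => σ.natArr arr (i.eval σ)
  | add e₁ e₂ => e₁.eval σ + e₂.eval σ
  | sub e₁ e₂ => e₁.eval σ - e₂.eval σ

/-- Number of steps to evaluate an index expression. -/
def NatExpr.cost : NatExpr → ℕ
  | const _ => 1
  | reg _ => 1
  | get _ i => i.cost + 1
  | add e₁ e₂ => e₁.cost + e₂.cost + 1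
  | sub e₁ e₂ => e₁.cost + e₂.cost + 1

/-- Value of a real expression. -/
noncomputable def RealExpr.eval (σ : Store) : RealExpr → ℝ
  | const q => (q : ℝ)
  | reg x => σ.realReg x
  | get arr i => σ.realArr arr (i.eval σ)
  | add e₁ e₂ => e₁.eval σ + e₂.eval σ
  | sub e₁ e₂ => e₁.eval σ - e₂.eval σ
  | mul e₁ e₂ => e₁.eval σ * e₂.eval σ

/-- Number of steps to evaluate a real expression. -/
def RealExpr.cost : RealExpr → ℕ
  | const _ => 1
  | reg _ => 1
  | get _ i => i.cost + 1
  | add e₁ e₂ => e₁.cost + e₂.cost + 1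
  | sub e₁ e₂ => e₁.cost + e₂.cost + 1
  | mul e₁ e₂ => e₁.cost + e₂.cost + 1

/-- Truth of a test. -/
def Test.Holds (σ : Store) : Test → Prop
  | natLe e₁ e₂ => e₁.eval σ ≤ e₂.eval σ
  | realLe e₁ e₂ => e₁.eval σ ≤ e₂.eval σ
  | not b => ¬ b.Holds σ
  | and b₁ b₂ => b₁.Holds σ ∧ b₂.Holds σ

/-- Number of steps to evaluate a test. -/
def Test.cost : Test → ℕ
  | natLe e₁ e₂ => e₁.cost + e₂.cost + 1
  | realLe e₁ e₂ => e₁.cost + e₂.cost + 1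
  | not b => b.cost + 1
  | and b₁ b₂ => b₁.cost + b₂.cost + 1

/-- Write an index register. -/
def Store.setNat (σ : Store) (x v : ℕ) : Store :=
  { σ with natReg := Function.update σ.natReg x v }

/-- Write a real register. -/
def Store.setReal (σ : Store) (x : ℕ) (v : ℝ) : Store :=
  { σ with realReg := Function.update σ.realReg x v }

/-- Write a cell of an index array. -/
def Store.putNat (σ : Store) (arr i v : ℕ) : Store :=
  { σ with natArr := Function.update σ.natArr arr (Function.update (σ.natArr arr) i v) }

/-- Write a cell of a real array. -/
def Store.putReal (σ : Store) (arr i : ℕ) (v : ℝ) : Store :=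
  { σ with realArr := Function.update σ.realArr arr (Function.update (σ.realArr arr) i v) }

/-- `Exec p σ t τ`: the program `p`, started in memory `σ`, halts after exactly `t` steps with
memory `τ`. -/
inductive Exec : Prog → Store → ℕ → Store → Prop
  | skip (σ) : Exec .skip σ 1 σ
  | setNat (σ x e) : Exec (.setNat x e) σ (e.cost + 1) (σ.setNat x (e.eval σ))
  | setReal (σ x e) : Exec (.setReal x e) σ (e.cost + 1) (σ.setReal x (e.eval σ))
  | putNat (σ arr i e) : Exec (.putNat arr i e) σ (i.cost + e.cost + 1)
      (σ.putNat arr (i.eval σ) (e.eval σ))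
  | putReal (σ arr i e) : Exec (.putReal arr i e) σ (i.cost + e.cost + 1)
      (σ.putReal arr (i.eval σ) (e.eval σ))
  | seq {p q σ₁ σ₂ σ₃ t₁ t₂} : Exec p σ₁ t₁ σ₂ → Exec q σ₂ t₂ σ₃ →
      Exec (.seq p q) σ₁ (t₁ + t₂) σ₃
  | iteTrue {b p q σ τ t} : b.Holds σ → Exec p σ t τ → Exec (.ite b p q) σ (b.cost + 1 + t) τ
  | iteFalse {b p q σ τ t} : ¬ b.Holds σ → Exec q σ t τ → Exec (.ite b p q) σ (b.cost + 1 + t) τ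
  | whileFalse {b p σ} : ¬ b.Holds σ → Exec (.while b p) σ (b.cost + 1) σ
  | whileTrue {b p σ₁ σ₂ σ₃ t₁ t₂} : b.Holds σ₁ → Exec p σ₁ t₁ σ₂ → Exec (.while b p) σ₂ t₂ σ₃ →
      Exec (.while b p) σ₁ (b.cost + 1 + t₁ + t₂) σ₃

/-- Execution is deterministic: the number of steps and the final memory are determined by the
program and the initial memory. -/
theorem Exec.deterministic {p : Prog} {σ τ τ' : Store} {t t' : ℕ}
    (h : Exec p σ t τ) (h' : Exec p σ t' τ') : t = t' ∧ τ = τ' := by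
  induction h generalizing t' τ' with
  | skip | setNat | setReal | putNat | putReal => cases h'; exact ⟨rfl, rfl⟩
  | seq _ _ ih₁ ih₂ =>
    cases h' with
    | seq h₁ h₂ =>
      obtain ⟨rfl, rfl⟩ := ih₁ h₁
      obtain ⟨rfl, rfl⟩ := ih₂ h₂
      exact ⟨rfl, rfl⟩
  | iteTrue hb _ ih =>
    cases h' with
    | iteTrue _ h₁ => obtain ⟨rfl, rfl⟩ := ih h₁; exact ⟨rfl, rfl⟩
    | iteFalse hb' _ => exact absurd hb hb'
  | iteFalse hb _ ih =>
    cases h' with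
    | iteTrue hb' _ => exact absurd hb' hb
    | iteFalse _ h₁ => obtain ⟨rfl, rfl⟩ := ih h₁; exact ⟨rfl, rfl⟩
  | whileFalse hb =>
    cases h' with
    | whileFalse => exact ⟨rfl, rfl⟩
    | whileTrue hb' _ _ => exact absurd hb' hb
  | whileTrue hb _ _ ih₁ ih₂ =>
    cases h' with
    | whileFalse hb' => exact absurd hb hb'
    | whileTrue _ h₁ h₂ =>
      obtain ⟨rfl, rfl⟩ := ih₁ h₁
      obtain ⟨rfl, rfl⟩ := ih₂ h₂
      exact ⟨rfl, rfl⟩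

/-! ### Input and output convention -/

/-- The memory `σ` holds the instance given by the points `a 0, …, a (n - 1)` of `ℝᵈ` and `k`:
the index registers `0, 1, 2` hold `d, n, k`, and the real array `0` lists the coordinates of the
points one point after the other.  Nothing is assumed on the other cells. -/
def HoldsInput {d n : ℕ} (a : Fin n → Fin d → ℝ) (k : ℕ) (σ : Store) : Prop :=
  σ.natReg 0 = d ∧ σ.natReg 1 = n ∧ σ.natReg 2 = k ∧
    ∀ (i : Fin n) (c : Fin d), σ.realArr 0 (d * i + c) = a i c

/-- The first `k` cells of the index array `0` of `τ` hold indices of points of the list `a`, and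
the set of these points is `S`. -/
def HoldsOutput {d n : ℕ} (a : Fin n → Fin d → ℝ) (k : ℕ) (S : Finset (Fin d → ℝ))
    (τ : Store) : Prop :=
  ∃ s : Fin k → Fin n, (∀ j : Fin k, τ.natArr 0 j = s j) ∧ S = Finset.univ.image (fun j => a (s j))

end ParetoPruning

/-!
In the plane, sorting the points of a Pareto set by the first coordinate `x` makes the second
coordinate decrease. With `u` the negated second coordinate, the directed distance from point `i` to
point `c` is `u c - u i` if `i ≤ c` and `x i - x c` if `c ≤ i`. So the problem is a center problem on
a line with two increasing coordinates, one for each direction, and some optimal solution serves a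
block of consecutive points from each center (`Reach`, `reach_of_cover`).

Let `F m i` be the least radius for which `m` centers cover the first `i` points, and let `G m c` be
the least radius for covering the points up to `c` by `m` centers and the center `c` itself. Both
recursions, from `F` to `G` (with `u`) and from `G` to `F` (with `x`), take the minimum over `a ≤ c`
of `max (f a) (u c - u a)` (`Smoothed`). Here `f` increases, and `u c - u a` decreases in `a` and
increases in `c`, so the two curves cross at a position that moves to the right with `c`. One layer
thus takes time `O(n)` with a single pointer (`run_smooth`), and `F k n`, the optimal radius, is found
in time `O(n k)` (`run_radiusProg`).

No back pointers are needed: given the optimal radius, a greedy choice of the centers from left to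
right, each as far to the right as possible, covers all points with `k` centers. Capping each greedy
choice so that enough positions remain for the later centers makes it use exactly `k` different ones
(`run_greedyProg`). Sorting is bottom-up merge sort, which takes time `O(n log n)` (`run_sortProg`).
A Pareto set with at most one objective has at most one point, which is treated separately.

Time bounds and correctness of the programs are proved together: `Run p σ T Q` says that `p` halts
within `T` steps in a memory satisfying `Q`. Loops are handled by an invariant and a potential that
pays for the iterations (`Run.while`), loop-free code by weakest preconditions (`Run.of_wp`), and
what a program does not assign to is unchanged by `Exec.frame`.
-/

namespace ParetoPruning

/-! ### Reasoning about programs -/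

/-- Started in `σ`, the program `p` halts after at most `T` steps in a memory satisfying `Q`. -/
def Run (p : Prog) (σ : Store) (T : ℕ) (Q : Store → Prop) : Prop :=
  ∃ t τ, Exec p σ t τ ∧ t ≤ T ∧ Q τ

theorem Run.mono {p : Prog} {σ : Store} {T T' : ℕ} {Q Q' : Store → Prop}
    (h : Run p σ T Q) (hT : T ≤ T') (hQ : ∀ τ, Q τ → Q' τ) : Run p σ T' Q' := by
  obtain ⟨t, τ, he, ht, hq⟩ := h
  exact ⟨t, τ, he, ht.trans hT, hQ τ hq⟩

theorem Run.seq {p q : Prog} {σ : Store} {T₁ T₂ : ℕ} {Q₁ Q : Store → Prop}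
    (h₁ : Run p σ T₁ Q₁) (h₂ : ∀ τ, Q₁ τ → Run q τ T₂ Q) : Run (.seq p q) σ (T₁ + T₂) Q := by
  obtain ⟨t₁, τ₁, he₁, ht₁, hq₁⟩ := h₁
  obtain ⟨t₂, τ₂, he₂, ht₂, hq₂⟩ := h₂ τ₁ hq₁
  exact ⟨t₁ + t₂, τ₂, .seq he₁ he₂, by omega, hq₂⟩

/-- Does the program contain an assignment to the index register `x`? -/
def Prog.setsNat : Prog → ℕ → Bool
  | .setNat y _, x => y == x
  | .seq p q, x => p.setsNat x || q.setsNat x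
  | .ite _ p q, x => p.setsNat x || q.setsNat x
  | .while _ p, x => p.setsNat x
  | _, _ => false

/-- Does the program contain an assignment to a cell of the index array `x`? -/
def Prog.putsNat : Prog → ℕ → Bool
  | .putNat y _ _, x => y == x
  | .seq p q, x => p.putsNat x || q.putsNat x
  | .ite _ p q, x => p.putsNat x || q.putsNat x
  | .while _ p, x => p.putsNat x
  | _, _ => false

/-- Does the program contain an assignment to a cell of the real array `x`? -/
def Prog.putsReal : Prog → ℕ → Bool
  | .putReal y _ _, x => y == x
  | .seq p q, x => p.putsReal x || q.putsReal x
  | .ite _ p q, x => p.putsReal x || q.putsReal x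
  | .while _ p, x => p.putsReal x
  | _, _ => false

/-- `σ` and `τ` agree on the index registers and arrays to which `p` contains no assignment.
Real registers are left out, because no program below uses them. -/
structure Frame (p : Prog) (σ τ : Store) : Prop where
  natReg : ∀ x, p.setsNat x = false → τ.natReg x = σ.natReg x
  natArr : ∀ x, p.putsNat x = false → τ.natArr x = σ.natArr x
  realArr : ∀ x, p.putsReal x = false → τ.realArr x = σ.realArr x

theorem Frame.refl (p : Prog) (σ : Store) : Frame p σ σ :=
  ⟨fun _ _ => rfl, fun _ _ => rfl, fun _ _ => rfl⟩

theorem Frame.trans {p : Prog} {σ τ υ : Store} (h₁ : Frame p σ τ) (h₂ : Frame p τ υ) :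
    Frame p σ υ :=
  ⟨fun x hx => (h₂.natReg x hx).trans (h₁.natReg x hx),
    fun x hx => (h₂.natArr x hx).trans (h₁.natArr x hx),
    fun x hx => (h₂.realArr x hx).trans (h₁.realArr x hx)⟩

theorem Exec.frame {p : Prog} {σ τ : Store} {t : ℕ} (h : Exec p σ t τ) : Frame p σ τ := by
  induction h with
  | skip => exact .refl _ _
  | setNat σ x e =>
    refine ⟨fun y hy => ?_, fun _ _ => rfl, fun _ _ => rfl⟩
    have : y ≠ x := by simp [Prog.setsNat] at hy; exact Ne.symm hy
    simp [Store.setNat, this]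
  | setReal => exact ⟨fun _ _ => rfl, fun _ _ => rfl, fun _ _ => rfl⟩
  | putNat σ x i e =>
    refine ⟨fun _ _ => rfl, fun y hy => ?_, fun _ _ => rfl⟩
    have : y ≠ x := by simp [Prog.putsNat] at hy; exact Ne.symm hy
    simp [Store.putNat, this]
  | putReal σ x i e =>
    refine ⟨fun _ _ => rfl, fun _ _ => rfl, fun y hy => ?_⟩
    have : y ≠ x := by simp [Prog.putsReal] at hy; exact Ne.symm hy
    simp [Store.putReal, this]
  | seq _ _ ih₁ ih₂ =>
    refine ⟨fun x hx => ?_, fun x hx => ?_, fun x hx => ?_⟩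
    · simp only [Prog.setsNat, Bool.or_eq_false_iff] at hx
      exact (ih₂.natReg x hx.2).trans (ih₁.natReg x hx.1)
    · simp only [Prog.putsNat, Bool.or_eq_false_iff] at hx
      exact (ih₂.natArr x hx.2).trans (ih₁.natArr x hx.1)
    · simp only [Prog.putsReal, Bool.or_eq_false_iff] at hx
      exact (ih₂.realArr x hx.2).trans (ih₁.realArr x hx.1)
  | iteTrue _ _ ih =>
    exact ⟨fun x hx => ih.natReg x (Bool.or_eq_false_iff.1 hx).1,
      fun x hx => ih.natArr x (Bool.or_eq_false_iff.1 hx).1,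
      fun x hx => ih.realArr x (Bool.or_eq_false_iff.1 hx).1⟩
  | iteFalse _ _ ih =>
    exact ⟨fun x hx => ih.natReg x (Bool.or_eq_false_iff.1 hx).2,
      fun x hx => ih.natArr x (Bool.or_eq_false_iff.1 hx).2,
      fun x hx => ih.realArr x (Bool.or_eq_false_iff.1 hx).2⟩
  | whileFalse => exact .refl _ _
  | whileTrue _ _ _ ih₁ ih₂ =>
    exact Frame.trans ⟨ih₁.natReg, ih₁.natArr, ih₁.realArr⟩ ih₂

theorem Run.frame {p : Prog} {σ : Store} {T : ℕ} {Q : Store → Prop} (h : Run p σ T Q) :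
    Run p σ T (fun τ => Q τ ∧ Frame p σ τ) := by
  obtain ⟨t, τ, he, ht, hq⟩ := h
  exact ⟨t, τ, he, ht, hq, he.frame⟩

/-- Loop rule with an invariant `I` and a potential `Φ` that pays for every iteration. -/
theorem Run.while {b : Test} {p : Prog} {σ₀ : Store} (I : Store → Prop) (Φ : Store → ℕ)
    (body : ∀ σ, Frame p σ₀ σ → I σ → b.Holds σ →
      ∃ T, Run p σ T (fun τ => I τ ∧ T + b.cost + 1 + Φ τ ≤ Φ σ))
    (h₀ : I σ₀) :
    Run (.while b p) σ₀ (Φ σ₀ + b.cost + 1) (fun τ => I τ ∧ ¬ b.Holds τ ∧ Frame p σ₀ τ) := by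
  suffices H : ∀ N σ, Φ σ ≤ N → Frame p σ₀ σ → I σ →
      Run (.while b p) σ (Φ σ + b.cost + 1) (fun τ => I τ ∧ ¬ b.Holds τ ∧ Frame p σ₀ τ) from
    H _ σ₀ le_rfl (.refl _ _) h₀
  intro N
  induction N with
  | zero =>
    intro σ hN hF hI
    by_cases hb : b.Holds σ
    · obtain ⟨T, t, τ, -, -, -, hT⟩ := body σ hF hI hb
      omega
    · exact ⟨_, σ, .whileFalse hb, by omega, hI, hb, hF⟩
  | succ N ih =>
    intro σ hN hF hI
    by_cases hb : b.Holds σ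
    · obtain ⟨T, t, τ, he, ht, hIτ, hT⟩ := body σ hF hI hb
      obtain ⟨t', υ, he', ht', hυ⟩ := ih τ (by omega) (hF.trans he.frame) hIτ
      exact ⟨_, υ, .whileTrue hb he he', by omega, hυ⟩
    · exact ⟨_, σ, .whileFalse hb, by omega, hI, hb, hF⟩

/-- Weakest precondition of a loop-free program. -/
def Prog.wp : Prog → (Store → Prop) → Store → Prop
  | .skip, Q, σ => Q σ
  | .setNat x e, Q, σ => Q (σ.setNat x (e.eval σ))
  | .setReal x e, Q, σ => Q (σ.setReal x (e.eval σ))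
  | .putNat x i e, Q, σ => Q (σ.putNat x (i.eval σ) (e.eval σ))
  | .putReal x i e, Q, σ => Q (σ.putReal x (i.eval σ) (e.eval σ))
  | .seq p q, Q, σ => p.wp (q.wp Q) σ
  | .ite b p q, Q, σ => (b.Holds σ → p.wp Q σ) ∧ (¬ b.Holds σ → q.wp Q σ)
  | .while _ _, _, _ => False

/-- Bound for the number of steps of a loop-free program. -/
def Prog.maxCost : Prog → ℕ
  | .skip => 1
  | .setNat _ e => e.cost + 1
  | .setReal _ e => e.cost + 1
  | .putNat _ i e => i.cost + e.cost + 1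
  | .putReal _ i e => i.cost + e.cost + 1
  | .seq p q => p.maxCost + q.maxCost
  | .ite b p q => b.cost + 1 + max p.maxCost q.maxCost
  | .while _ _ => 0

theorem Run.of_wp {p : Prog} {σ : Store} {Q : Store → Prop} {T : ℕ} (hT : p.maxCost ≤ T)
    (h : p.wp Q σ) : Run p σ T Q := by
  suffices H : Run p σ p.maxCost Q from H.mono hT (fun _ h => h)
  clear hT
  induction p generalizing σ Q with
  | skip => exact ⟨_, _, .skip σ, le_rfl, h⟩
  | setNat x e => exact ⟨_, _, .setNat σ x e, le_rfl, h⟩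
  | setReal x e => exact ⟨_, _, .setReal σ x e, le_rfl, h⟩
  | putNat x i e => exact ⟨_, _, .putNat σ x i e, le_rfl, h⟩
  | putReal x i e => exact ⟨_, _, .putReal σ x i e, le_rfl, h⟩
  | seq p q ihp ihq => exact (ihp h).seq (fun τ hτ => ihq hτ)
  | ite b p q ihp ihq =>
    by_cases hb : b.Holds σ
    · obtain ⟨t, τ, he, ht, hq⟩ := ihp (h.1 hb)
      exact ⟨_, τ, .iteTrue hb he, by simp only [Prog.maxCost]; omega, hq⟩
    · obtain ⟨t, τ, he, ht, hq⟩ := ihq (h.2 hb)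
      exact ⟨_, τ, .iteFalse hb he, by simp only [Prog.maxCost]; omega, hq⟩
  | _ => exact h.elim

/-! ### Reading an updated memory -/

section Store

variable (σ : Store) (x i v : ℕ) (r : ℝ)

@[simp] theorem Store.setNat_natReg (y : ℕ) :
    (σ.setNat x v).natReg y = if y = x then v else σ.natReg y := by
  simp [setNat, Function.update_apply]

@[simp] theorem Store.setNat_natArr : (σ.setNat x v).natArr = σ.natArr := rfl

@[simp] theorem Store.setNat_realArr : (σ.setNat x v).realArr = σ.realArr := rfl

@[simp] theorem Store.putNat_natReg : (σ.putNat x i v).natReg = σ.natReg := rfl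

@[simp] theorem Store.putNat_natArr (y : ℕ) : (σ.putNat x i v).natArr y =
    if y = x then Function.update (σ.natArr x) i v else σ.natArr y := by
  simp [putNat, Function.update_apply]

@[simp] theorem Store.putReal_natReg : (σ.putReal x i r).natReg = σ.natReg := rfl

@[simp] theorem Store.putReal_natArr : (σ.putReal x i r).natArr = σ.natArr := rfl

@[simp] theorem Store.putReal_realArr (y : ℕ) : (σ.putReal x i r).realArr y =
    if y = x then Function.update (σ.realArr x) i r else σ.realArr y := by
  simp [putReal, Function.update_apply]

end Store

/-! ### Covering sorted points by few centers -/

/-- The first `i` points can be cut into at most `m` consecutive blocks, each of which lies within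
distance `v` of one of its points.  Here `x` and `u` are the coordinates of the sorted points, the
second one negated, so that both increase: the point `j` is at distance `u c - u j` from a center
`c ≥ j`, and at distance `x j - x c` from a center `c ≤ j`. -/
def Reach (x u : ℕ → ℝ) (v : ℝ) : ℕ → ℕ → Prop
  | 0, i => i = 0
  | m + 1, i => i = 0 ∨
      ∃ a c, Reach x u v m a ∧ a ≤ c ∧ c < i ∧ u c - u a ≤ v ∧ x (i - 1) - x c ≤ v

theorem reach_zero (x u : ℕ → ℝ) (v : ℝ) (m : ℕ) : Reach x u v m 0 := by
  cases m <;> simp [Reach]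

/-- If at most `m` centers cover the first `i` points, then blocks as in `Reach` exist.  The last
block is taken to start at the first point that is not covered by the centers other than the
last one. -/
theorem reach_of_cover {x u : ℕ → ℝ} {v : ℝ} {n : ℕ} (hx : MonotoneOn x (Set.Iio n))
    (hu : MonotoneOn u (Set.Iio n)) (hv : 0 ≤ v) {m : ℕ} {T : Finset ℕ} (hT : T.card ≤ m)
    (hTn : ∀ t ∈ T, t < n) {i : ℕ} (hi : i ≤ n)
    (h : ∀ j < i, ∃ t ∈ T, (j ≤ t ∧ u t - u j ≤ v) ∨ (t ≤ j ∧ x j - x t ≤ v)) :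
    Reach x u v m i := by
  classical
  induction m generalizing T i with
  | zero =>
    rcases Nat.eq_zero_or_pos i with rfl | hi0
    · exact reach_zero ..
    · obtain ⟨t, ht, -⟩ := h 0 hi0
      simp [Finset.card_eq_zero.1 (Nat.le_zero.1 hT)] at ht
  | succ m ih =>
    rcases Nat.eq_zero_or_pos i with rfl | hi0
    · exact reach_zero ..
    have hne : T.Nonempty := by
      obtain ⟨t, ht, -⟩ := h 0 hi0
      exact ⟨t, ht⟩
    set c := T.max' hne with hc
    have hcT : c ∈ T := T.max'_mem hne
    have hmax : ∀ t ∈ T, t ≤ c := fun t ht => T.le_max' t ht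
    have hcn : c < n := hTn c hcT
    have hcard : (T.erase c).card ≤ m := by rw [Finset.card_erase_of_mem hcT]; omega
    have hsub : ∀ t ∈ T.erase c, t < n := fun t ht => hTn t (Finset.mem_of_mem_erase ht)
    -- the center is replaced by the last of the first `i` points, if it lies further right
    obtain ⟨c', hc'⟩ : ∃ c', c' = min c (i - 1) := ⟨_, rfl⟩
    have hxc : x (i - 1) - x c' ≤ v := by
      rcases le_or_gt (i - 1) c with h1 | h1
      · rw [hc', min_eq_right h1]; simpa using hv
      · rw [hc', min_eq_left h1.le]
        obtain ⟨t, ht, ⟨h2, -⟩ | ⟨h2, h3⟩⟩ := h (i - 1) (by omega)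
        · have := hmax t ht; omega
        · have h4 := hx (a := t) (b := c) (hTn t ht) hcn (hmax t ht)
          linarith
    let Q : ℕ → Prop := fun j =>
      ∃ t ∈ T.erase c, (j ≤ t ∧ u t - u j ≤ v) ∨ (t ≤ j ∧ x j - x t ≤ v)
    right
    by_cases hall : ∀ j < c', Q j
    · refine ⟨c', c', ih hcard hsub (by omega) hall, le_rfl, by omega, by simpa using hv, hxc⟩
    · have hex : ∃ j, j < c' ∧ ¬ Q j := by simpa using hall
      set a := Nat.find hex with ha
      obtain ⟨hac, haQ⟩ := Nat.find_spec hex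
      have hfirst : ∀ j < a, Q j := fun j hj => by
        by_contra hq
        exact Nat.find_min hex hj ⟨by omega, hq⟩
      refine ⟨a, c', ih hcard hsub (by omega) hfirst, by omega, by omega, ?_, hxc⟩
      obtain ⟨t, ht, h2⟩ := h a (by omega)
      have htc : t = c := by
        by_contra htc
        exact haQ ⟨t, Finset.mem_erase.2 ⟨htc, ht⟩, h2⟩
      rw [htc] at h2
      rcases h2 with ⟨-, h2⟩ | ⟨h2, -⟩
      · have h4 := hu (a := c') (b := c) (show c' < n by omega) hcn (by omega)
        linarith
      · omega

/-! ### The recursion of the dynamic program -/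

/-- `g c` is the minimum of `max (f a) (u c - u a)` over `a ≤ c`, for all `c < n`. -/
def Smoothed (n : ℕ) (u f g : ℕ → ℝ) : Prop :=
  ∀ c < n, ∀ v, g c ≤ v ↔ ∃ a ≤ c, f a ≤ v ∧ u c - u a ≤ v

theorem Smoothed.monotoneOn {n : ℕ} {u f g : ℕ → ℝ} (h : Smoothed n u f g)
    (hu : MonotoneOn u (Set.Iio n)) (hf : MonotoneOn f (Set.Iio n)) :
    MonotoneOn g (Set.Iio n) := by
  intro c hc c' hc' hcc
  have hc : c < n := hc
  have hc' : c' < n := hc'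
  obtain ⟨a, hac, hfa, hua⟩ := (h c' hc' _).1 le_rfl
  refine (h c hc _).2 ?_
  rcases le_or_gt a c with h1 | h1
  · have := hu (a := c) (b := c') hc hc' hcc
    exact ⟨a, h1, hfa, by linarith⟩
  · have := hf (a := c) (b := a) hc (show a < n by omega) h1.le
    have := hu (a := a) (b := c') (show a < n by omega) hc' hac
    exact ⟨c, le_rfl, by linarith, by linarith⟩

theorem Smoothed.nonneg {n : ℕ} {u f g : ℕ → ℝ} (h : Smoothed n u f g)
    (hu : MonotoneOn u (Set.Iio n)) {c : ℕ} (hc : c < n) : 0 ≤ g c := by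
  obtain ⟨a, hac, -, hua⟩ := (h c hc _).1 le_rfl
  have := hu (a := a) (b := c) (show a < n by omega) hc hac
  linarith

/-- `f i` is the least radius for which `m` centers can cover the first `i` points. -/
def IsCost (x u : ℕ → ℝ) (n m : ℕ) (f : ℕ → ℝ) : Prop :=
  ∀ i ≤ n, ∀ v, f i ≤ v ↔ 0 ≤ v ∧ Reach x u v m i

/-- `g c` is the least radius for which `m` centers to the left of the point `c`, together with `c`
itself, can cover the points up to `c`. -/
def IsCenterCost (x u : ℕ → ℝ) (n m : ℕ) (g : ℕ → ℝ) : Prop :=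
  ∀ c < n, ∀ v, g c ≤ v ↔ ∃ a ≤ c, Reach x u v m a ∧ u c - u a ≤ v

theorem isCenterCost_zero (x u : ℕ → ℝ) {n : ℕ} {g : ℕ → ℝ} (hg : ∀ c < n, g c = u c - u 0) :
    IsCenterCost x u n 0 g := by
  intro c hc v
  rw [hg c hc]
  constructor
  · intro h; exact ⟨0, by omega, rfl, h⟩
  · rintro ⟨a, -, rfl, h⟩; exact h

theorem IsCenterCost.isCost {x u : ℕ → ℝ} {n m : ℕ} {g f : ℕ → ℝ} (hg : IsCenterCost x u n m g)
    (hx : MonotoneOn x (Set.Iio n)) (hf0 : f 0 = 0)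
    (hf : Smoothed n x g (fun c => f (c + 1))) : IsCost x u n (m + 1) f := by
  intro i hi v
  rcases i with _ | i
  · simp [hf0, reach_zero]
  · rw [hf i hi v]
    simp only [Reach, Nat.add_one_ne_zero, false_or, Nat.add_sub_cancel]
    constructor
    · rintro ⟨c, hc, h1, h2⟩
      obtain ⟨a, hac, h3, h4⟩ := (hg c (by omega) v).1 h1
      have := hx (a := c) (b := i) (show c < n by omega) hi hc
      exact ⟨by linarith, a, c, h3, hac, by omega, h4, h2⟩
    · rintro ⟨-, a, c, h3, hac, hc, h4, h2⟩
      exact ⟨c, by omega, (hg c (by omega) v).2 ⟨a, hac, h3, h4⟩, h2⟩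

theorem IsCost.isCenterCost {x u : ℕ → ℝ} {n m : ℕ} {g f : ℕ → ℝ} (hf : IsCost x u n m f)
    (hu : MonotoneOn u (Set.Iio n)) (hg : Smoothed n u f g) : IsCenterCost x u n m g := by
  intro c hc v
  rw [hg c hc v]
  refine exists_congr fun a => and_congr_right fun hac => ?_
  rw [hf a (by omega) v]
  have := hu (a := a) (b := c) (show a < n by omega) hc hac
  exact ⟨fun h => ⟨h.1.2, h.2⟩, fun h => ⟨⟨by linarith, h.1⟩, h.2⟩⟩

/-! ### Counting loops -/

/-- The test `e < f`. -/
abbrev Test.natLt (e f : NatExpr) : Test := .natLe (.add e (.const 1)) f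

/-- Increment an index register. -/
abbrev Prog.incr (x : ℕ) : Prog := .setNat x (.add (.reg x) (.const 1))

/-- Run `p` with the index register `i` counting from `0` up to, but not including, the value of the
index register `n`. -/
abbrev Prog.forRange (i n : ℕ) (p : Prog) : Prog :=
  .seq (.setNat i (.const 0)) (.while (.natLt (.reg i) (.reg n)) (.seq p (.incr i)))

theorem Run.forRange {i n : ℕ} {p : Prog} {σ₀ : Store} (I : ℕ → Store → Prop) (K : ℕ)
    (hi : p.setsNat i = false) (hn : p.setsNat n = false) (hin : i ≠ n)
    (h₀ : I 0 (σ₀.setNat i 0))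
    (body : ∀ j < σ₀.natReg n, ∀ σ, Frame (.forRange i n p) σ₀ σ → σ.natReg i = j → I j σ →
      Run p σ K (fun τ => I (j + 1) (τ.setNat i (j + 1)))) :
    Run (.forRange i n p) σ₀ (σ₀.natReg n * (K + 10) + 8)
      (fun τ => I (σ₀.natReg n) τ ∧ Frame (.forRange i n p) σ₀ τ) := by
  set N := σ₀.natReg n with hN
  have h1 : Run (.setNat i (.const 0)) σ₀ 2 (fun τ => τ = σ₀.setNat i 0) := .of_wp le_rfl rfl
  have h2 : ∀ τ, τ = σ₀.setNat i 0 →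
      Run (.while (.natLt (.reg i) (.reg n)) (.seq p (.incr i))) τ (N * (K + 10) + 6)
        (fun τ => I N τ) := by
    rintro _ rfl
    have hset : Frame (.forRange i n p) σ₀ (σ₀.setNat i 0) :=
      (Exec.setNat σ₀ i (.const 0)).frame |> fun h =>
        ⟨fun x hx => h.natReg x (Bool.or_eq_false_iff.1 hx).1, fun _ _ => rfl, fun _ _ => rfl⟩
    have h3 := Run.while (b := .natLt (.reg i) (.reg n)) (p := .seq p (.incr i))
      (σ₀ := σ₀.setNat i 0)
      (I := fun σ => σ.natReg i ≤ N ∧ σ.natReg n = N ∧ I (σ.natReg i) σ)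
      (Φ := fun σ => (N - σ.natReg i) * (K + 10))
      (by
        intro σ hF ⟨hiN, hnN, hI⟩ hb
        have hlt : σ.natReg i < N := by
          have : σ.natReg i + 1 ≤ σ.natReg n := hb
          omega
        refine ⟨K + 4, Run.seq (body _ hlt σ ?_ rfl hI).frame (T₂ := 4) ?_⟩
        · refine hset.trans ⟨fun x hx => hF.natReg x ?_, fun x hx => hF.natArr x ?_,
            fun x hx => hF.realArr x ?_⟩
          · exact (Bool.or_eq_false_iff.1 hx).2
          · exact (Bool.or_eq_false_iff.1 hx).2
          · exact (Bool.or_eq_false_iff.1 hx).2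
        · rintro τ ⟨hτ, hFτ⟩
          refine .of_wp le_rfl ?_
          have hτi : τ.natReg i = σ.natReg i := hFτ.natReg i hi
          have hτn : τ.natReg n = σ.natReg n := hFτ.natReg n hn
          simp only [Prog.wp, NatExpr.eval, hτi, Store.setNat_natReg, if_true, hin.symm,
            if_false, hτn]
          refine ⟨⟨hlt, hnN, hτ⟩, ?_⟩
          obtain ⟨k, hk⟩ : ∃ k, N - σ.natReg i = k + 1 := ⟨N - σ.natReg i - 1, by omega⟩
          rw [hk, show N - (σ.natReg i + 1) = k by omega, Nat.add_one_mul]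
          simp only [Test.cost, NatExpr.cost]
          omega)
      (by simpa [hin.symm, ← hN] using h₀)
    refine h3.mono ?_ ?_
    · simp [Test.cost, NatExpr.cost]
    · rintro τ ⟨⟨hiN, hnN, hI⟩, hb, -⟩
      have hb : ¬ τ.natReg i + 1 ≤ τ.natReg n := hb
      have : τ.natReg i = N := by omega
      rwa [this] at hI
  exact (Run.seq h1 h2).frame.mono (by omega) fun _ h => h

/-! ### One step of the dynamic program -/

/-- If `p` is the last position up to `c` with `f p ≤ u c - u p`, then the minimum of
`max (f a) (u c - u a)` over `a ≤ c` is attained at `p` or at `p + 1`. -/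
theorem crossing_min {n p c : ℕ} {u f : ℕ → ℝ} (hu : MonotoneOn u (Set.Iio n))
    (hf : MonotoneOn f (Set.Iio n)) (hc : c < n) (hpc : p ≤ c) (hp : f p ≤ u c - u p)
    (hp' : p < c → u c - u (p + 1) < f (p + 1)) (v : ℝ) :
    (if p < c ∧ f (p + 1) ≤ u c - u p then f (p + 1) else u c - u p) ≤ v ↔
      ∃ a ≤ c, f a ≤ v ∧ u c - u a ≤ v := by
  have hu' : ∀ a b, a ≤ b → b < n → u a ≤ u b := fun a b h hb =>
    hu (show a < n by omega) hb h
  have hf' : ∀ a b, a ≤ b → b < n → f a ≤ f b := fun a b h hb =>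
    hf (show a < n by omega) hb h
  split_ifs with h
  · constructor
    · intro hv
      exact ⟨p + 1, h.1, hv, (hp' h.1).le.trans hv⟩
    · rintro ⟨a, hac, hfa, hua⟩
      rcases le_or_gt a p with h1 | h1
      · have := hu' a p h1 (by omega)
        linarith [h.2]
      · exact (hf' (p + 1) a h1 (by omega)).trans hfa
  · constructor
    · intro hv
      exact ⟨p, hpc, hp.trans hv, hv⟩
    · rintro ⟨a, hac, hfa, hua⟩
      rcases le_or_gt a p with h1 | h1
      · have := hu' a p h1 (by omega)
        linarith
      · have h2 : ¬ f (p + 1) ≤ u c - u p := fun h3 => h ⟨by omega, h3⟩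
        have := hf' (p + 1) a h1 (by omega)
        linarith

/-- The loop body of `smooth`. -/
abbrev smoothBody (u f g off : ℕ) : Prog :=
  .ite (.and (.natLt (.reg 5) (.reg 4))
      (.realLe (.get f (.add (.reg 5) (.const 1)))
        (.sub (.get u (.reg 4)) (.get u (.add (.reg 5) (.const 1))))))
    (.incr 5)
    (.seq
      (.ite (.and (.natLt (.reg 5) (.reg 4))
          (.realLe (.get f (.add (.reg 5) (.const 1)))
            (.sub (.get u (.reg 4)) (.get u (.reg 5)))))
        (.putReal g (.add (.reg 4) (.const off)) (.get f (.add (.reg 5) (.const 1))))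
        (.putReal g (.add (.reg 4) (.const off)) (.sub (.get u (.reg 4)) (.get u (.reg 5)))))
      (.incr 4))

/-- Compute, from the real arrays `u` and `f`, the array `g` in the sense of `Smoothed`, shifted by
`off` cells.  Register `4` holds the position `c` to be computed; register `5` holds the candidate
`p` for the last position with `f p ≤ u c - u p`, which moves to the right only. -/
abbrev smooth (u f g off : ℕ) : Prog :=
  .seq (.setNat 4 (.const 0)) (.seq (.setNat 5 (.const 0))
    (.while (.natLt (.reg 4) (.reg 1)) (smoothBody u f g off)))

theorem run_smooth {u f g off : ℕ} (hug : u ≠ g) (hfg : f ≠ g) {σ₀ : Store} {n : ℕ}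
    (hn : σ₀.natReg 1 = n) (hu : MonotoneOn (σ₀.realArr u) (Set.Iio n))
    (hf : MonotoneOn (σ₀.realArr f) (Set.Iio n)) (hf0 : σ₀.realArr f 0 ≤ 0) :
    Run (smooth u f g off) σ₀ (120 * n + 10) (fun τ =>
      Smoothed n (σ₀.realArr u) (σ₀.realArr f) (fun c => τ.realArr g (c + off)) ∧
      ∀ j < off, τ.realArr g j = σ₀.realArr g j) := by
  set U := σ₀.realArr u with hU
  set F := σ₀.realArr f with hF
  set σ₁ := (σ₀.setNat 4 0).setNat 5 0 with hσ₁
  have h0 : Run (smooth u f g off) σ₀ (2 + (2 + (120 * n + 6))) (fun τ =>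
      Smoothed n U F (fun c => τ.realArr g (c + off)) ∧
      ∀ j < off, τ.realArr g j = σ₀.realArr g j) := by
    refine Run.seq (Q₁ := fun τ => τ = σ₀.setNat 4 0) (.of_wp le_rfl rfl) ?_
    rintro _ rfl
    refine Run.seq (Q₁ := fun τ => τ = σ₁) (.of_wp le_rfl rfl) ?_
    rintro _ rfl
    refine (Run.while (σ₀ := σ₁) (I := fun σ => σ.natReg 5 ≤ σ.natReg 4 ∧ σ.natReg 4 ≤ n ∧
        (σ.natReg 4 < n → F (σ.natReg 5) ≤ U (σ.natReg 4) - U (σ.natReg 5)) ∧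
        (∀ c < σ.natReg 4, ∀ v, σ.realArr g (c + off) ≤ v ↔ ∃ a ≤ c, F a ≤ v ∧ U c - U a ≤ v) ∧
        ∀ j < off, σ.realArr g j = σ₀.realArr g j)
      (Φ := fun σ => 60 * ((n - σ.natReg 4) + (n - σ.natReg 5))) ?_ ?_).mono ?_ ?_
    · rintro σ hFr ⟨hpc, hcn, hfp, hspec, hlow⟩ hb
      have h1 : σ.natReg 1 = n := by
        rw [hFr.natReg 1 (by simp [Prog.setsNat]), hσ₁]; simpa using hn
      have hσu : σ.realArr u = U := by
        rw [hFr.realArr u (by simp [Prog.putsReal, hug.symm]), hσ₁]; rfl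
      have hσf : σ.realArr f = F := by
        rw [hFr.realArr f (by simp [Prog.putsReal, hfg.symm]), hσ₁]; rfl
      have hlt : σ.natReg 4 < n := by
        have : σ.natReg 4 + 1 ≤ σ.natReg 1 := hb
        omega
      set c := σ.natReg 4 with hc
      set p := σ.natReg 5 with hp
      refine ⟨50, .of_wp ?_ ⟨?_, ?_⟩⟩
      · simp [Prog.maxCost, Test.cost, NatExpr.cost, RealExpr.cost]
      · intro hb
        simp only [Test.Holds, NatExpr.eval, RealExpr.eval, hσu, hσf, ← hc, ← hp] at hb
        simp only [Prog.wp, NatExpr.eval, Store.setNat_natReg, Store.setNat_realArr, if_true,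
          Nat.reduceEqDiff, if_false, ← hc, ← hp, Test.cost, NatExpr.cost]
        exact ⟨⟨hb.1, hcn, fun _ => hb.2, hspec, hlow⟩, by omega⟩
      · intro hb
        simp only [Test.Holds, NatExpr.eval, RealExpr.eval, hσu, hσf, ← hc, ← hp, not_and,
          not_le] at hb
        have hmin := crossing_min hu hf hlt hpc (hfp hlt) hb
        have hnext : c + 1 < n → F p ≤ U (c + 1) - U p := fun h => by
          have := hu (show c < n by omega) (show c + 1 < n from h) (by omega)
          linarith [hfp hlt]
        have key : ∀ r : ℝ, (∀ v, r ≤ v ↔ ∃ a ≤ c, F a ≤ v ∧ U c - U a ≤ v) →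
            (∀ c' < c + 1, ∀ v, Function.update (σ.realArr g) (c + off) r (c' + off) ≤ v ↔
              ∃ a ≤ c', F a ≤ v ∧ U c' - U a ≤ v) ∧
            ∀ j < off, Function.update (σ.realArr g) (c + off) r j = σ₀.realArr g j := by
          intro r hr
          refine ⟨fun c' hc' v => ?_, fun j hj => ?_⟩
          · rcases Nat.lt_succ_iff_lt_or_eq.1 hc' with h | rfl
            · rw [Function.update_of_ne (by omega)]; exact hspec c' h v
            · rw [Function.update_self]; exact hr v
          · rw [Function.update_of_ne (by omega)]; exact hlow j hj
        constructor
        · intro hb2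
          simp only [Test.Holds, NatExpr.eval, RealExpr.eval, hσu, hσf, ← hc, ← hp] at hb2
          simp only [if_pos (show p < c ∧ F (p + 1) ≤ U c - U p from hb2)] at hmin
          simp only [Prog.wp, NatExpr.eval, Store.setNat_natReg, Store.setNat_realArr, if_true,
            Nat.reduceEqDiff, if_false, Test.cost, NatExpr.cost, RealExpr.eval,
            Store.putReal_natReg, Store.putReal_realArr, hσf, ← hc, ← hp]
          exact ⟨⟨by omega, hlt, hnext, key _ hmin⟩, by omega⟩
        · intro hb2
          simp only [Test.Holds, NatExpr.eval, RealExpr.eval, hσu, hσf, ← hc, ← hp] at hb2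
          simp only [if_neg (show ¬ (p < c ∧ F (p + 1) ≤ U c - U p) from hb2)] at hmin
          simp only [Prog.wp, NatExpr.eval, Store.setNat_natReg, Store.setNat_realArr, if_true,
            Nat.reduceEqDiff, if_false, Test.cost, NatExpr.cost, RealExpr.eval,
            Store.putReal_natReg, Store.putReal_realArr, hσu, ← hc, ← hp]
          exact ⟨⟨by omega, hlt, hnext, key _ hmin⟩, by omega⟩
    · simpa [hσ₁] using fun _ => hf0
    · simp [hσ₁, Test.cost, NatExpr.cost]; omega
    · rintro τ ⟨⟨hpc, hcn, hfp, hspec, hlow⟩, hb, hFr⟩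
      have h1 : τ.natReg 1 = n := by
        rw [hFr.natReg 1 (by simp [Prog.setsNat]), hσ₁]; simpa using hn
      have hb : ¬ τ.natReg 4 + 1 ≤ τ.natReg 1 := hb
      exact ⟨fun c hc => hspec c (by omega), hlow⟩
  exact h0.mono (by omega) fun _ h => h

/-! ### The optimal radius -/

/-- The dynamic program.  The real arrays `1` and `2` hold the coordinates `x` and `u`, array `3`
holds the costs with a prescribed last center, and array `4` the costs of covering initial
segments. -/
abbrev radiusProg : Prog :=
  .forRange 3 2 (.seq (smooth 1 3 4 1) (smooth 2 4 3 0))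

theorem run_radiusProg {σ₀ : Store} {n k : ℕ} {x u : ℕ → ℝ} (hn : σ₀.natReg 1 = n) (hn0 : 0 < n)
    (hk : σ₀.natReg 2 = k) (hk0 : 0 < k) (hxσ : σ₀.realArr 1 = x) (huσ : σ₀.realArr 2 = u)
    (hx : MonotoneOn x (Set.Iio n)) (hu : MonotoneOn u (Set.Iio n))
    (hg : ∀ c < n, σ₀.realArr 3 c = u c - u 0) (hf : σ₀.realArr 4 0 = 0) :
    Run radiusProg σ₀ (k * (240 * n + 30) + 8) (fun τ => IsCost x u n k (τ.realArr 4)) := by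
  have h := Run.forRange (i := 3) (n := 2) (p := .seq (smooth 1 3 4 1) (smooth 2 4 3 0))
    (σ₀ := σ₀)
    (I := fun m σ => IsCenterCost x u n m (σ.realArr 3) ∧
      MonotoneOn (σ.realArr 3) (Set.Iio n) ∧ σ.realArr 4 0 = 0 ∧
      (0 < m → IsCost x u n m (σ.realArr 4)))
    (240 * n + 20) rfl rfl (by decide) ?_ ?_
  · rw [hk] at h
    exact h.mono (by ring_nf; rfl) fun τ hτ => hτ.1.2.2.2 hk0
  · refine ⟨isCenterCost_zero x u hg, ?_, hf, fun h => absurd h (lt_irrefl 0)⟩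
    intro c hc c' hc' hcc
    have := hu hc hc' hcc
    simp only [Store.setNat_realArr]
    rw [hg c hc, hg c' hc']
    linarith
  · rintro m - σ hF - ⟨hG, hGm, hF0, -⟩
    have hσn : σ.natReg 1 = n := (hF.natReg 1 rfl).trans hn
    have hσx : σ.realArr 1 = x := (hF.realArr 1 rfl).trans hxσ
    have hσu : σ.realArr 2 = u := (hF.realArr 2 rfl).trans huσ
    have hG0 : σ.realArr 3 0 ≤ 0 :=
      (hG 0 hn0 0).2 ⟨0, le_rfl, reach_zero .., by simp⟩
    have h1 := (run_smooth (u := 1) (f := 3) (g := 4) (off := 1) (by decide) (by decide) hσn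
      (by rwa [hσx]) hGm hG0).frame
    rw [hσx] at h1
    refine (Run.seq (T₂ := 120 * n + 10) h1 ?_).mono (by omega) fun _ h => h
    rintro τ ⟨⟨hS, hlow⟩, hFr⟩
    have hτ0 : τ.realArr 4 0 = 0 := (hlow 0 one_pos).trans hF0
    have hcost : IsCost x u n (m + 1) (τ.realArr 4) := hG.isCost hx hτ0 hS
    have hSm := hS.monotoneOn hx hGm
    have hτm : MonotoneOn (τ.realArr 4) (Set.Iio n) := by
      intro i hi j hj hij
      have hi : i < n := hi
      have hj : j < n := hj
      rcases j with _ | j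
      · rw [Nat.le_zero.1 hij]
      · rcases i with _ | i
        · rw [hτ0]; exact hS.nonneg hx (by omega)
        · exact hSm (show i < n by omega) (show j < n by omega) (by omega)
    have hτu : τ.realArr 2 = u := (hFr.realArr 2 rfl).trans hσu
    have h2 := (run_smooth (u := 2) (f := 4) (g := 3) (off := 0) (by decide) (by decide)
      ((hFr.natReg 1 rfl).trans hσn) (by rwa [hτu]) hτm hτ0.le).frame
    rw [hτu] at h2
    refine h2.mono le_rfl ?_
    rintro υ ⟨⟨hS', -⟩, hFr'⟩
    have hυ4 : υ.realArr 4 = τ.realArr 4 := hFr'.realArr 4 rfl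
    exact ⟨hcost.isCenterCost hu hS', hS'.monotoneOn hu hτm, by simpa [hυ4] using hτ0,
      fun _ => by simpa [hυ4] using hcost⟩

/-! ### The coordinates in sorted order -/

/-- The real arrays hold the coordinates of the points, in the order of the index array `1`: the
first one in array `1`, the second one, negated, in array `2`.  Arrays `3` and `4` are initialized
for the dynamic program. -/
abbrev fillProg : Prog :=
  .seq (.forRange 3 1
    (.seq (.putReal 1 (.reg 3) (.get 0 (.add (.get 1 (.reg 3)) (.get 1 (.reg 3)))))
    (.seq (.putReal 2 (.reg 3) (.sub (.const 0)
        (.get 0 (.add (.add (.get 1 (.reg 3)) (.get 1 (.reg 3))) (.const 1)))))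
      (.putReal 3 (.reg 3) (.sub (.get 2 (.reg 3)) (.get 2 (.const 0)))))))
    (.putReal 4 (.const 0) (.const 0))

theorem run_fillProg {σ₀ : Store} {n : ℕ} {s : ℕ → ℕ} {z : ℕ → ℝ} (hn : σ₀.natReg 1 = n)
    (hs : σ₀.natArr 1 = s) (hz : σ₀.realArr 0 = z) :
    Run fillProg σ₀ (50 * n + 20) (fun τ =>
      (∀ i < n, τ.realArr 1 i = z (s i + s i)) ∧ (∀ i < n, τ.realArr 2 i = -z (s i + s i + 1)) ∧
      (∀ i < n, τ.realArr 3 i = τ.realArr 2 i - τ.realArr 2 0) ∧ τ.realArr 4 0 = 0) := by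
  have h := Run.forRange (i := 3) (n := 1)
    (p := (.seq (.putReal 1 (.reg 3) (.get 0 (.add (.get 1 (.reg 3)) (.get 1 (.reg 3)))))
      (.seq (.putReal 2 (.reg 3) (.sub (.const 0)
        (.get 0 (.add (.add (.get 1 (.reg 3)) (.get 1 (.reg 3))) (.const 1)))))
      (.putReal 3 (.reg 3) (.sub (.get 2 (.reg 3)) (.get 2 (.const 0)))))))
    (σ₀ := σ₀)
    (I := fun m σ => (∀ i < m, σ.realArr 1 i = z (s i + s i)) ∧
      (∀ i < m, σ.realArr 2 i = -z (s i + s i + 1)) ∧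
      (∀ i < m, σ.realArr 3 i = σ.realArr 2 i - σ.realArr 2 0))
    40 rfl rfl (by decide) (by simp) ?_
  · rw [hn] at h
    refine (Run.seq (T₂ := 3) h (Q := fun τ =>
      (∀ i < n, τ.realArr 1 i = z (s i + s i)) ∧ (∀ i < n, τ.realArr 2 i = -z (s i + s i + 1)) ∧
      (∀ i < n, τ.realArr 3 i = τ.realArr 2 i - τ.realArr 2 0) ∧ τ.realArr 4 0 = 0) ?_).mono
      (by omega) fun _ h => h
    rintro τ ⟨⟨h1, h2, h3⟩, -⟩
    refine .of_wp le_rfl ?_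
    simpa [Prog.wp, NatExpr.eval, RealExpr.eval] using ⟨h1, h2, h3⟩
  · rintro j - σ hF hj ⟨h1, h2, h3⟩
    have hσs : σ.natArr 1 = s := (hF.natArr 1 rfl).trans hs
    have hσz : σ.realArr 0 = z := (hF.realArr 0 rfl).trans hz
    refine .of_wp (by decide) ?_
    simp only [Prog.wp, NatExpr.eval, RealExpr.eval, Store.setNat_realArr, Store.putReal_natReg,
      Store.putReal_realArr, Store.putReal_natArr, hσs, hσz, hj, Nat.reduceEqDiff, if_false,
      if_true, Rat.cast_zero, zero_sub, Function.update_self]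
    refine ⟨fun i hi => ?_, fun i hi => ?_, fun i hi => ?_⟩
    · rcases Nat.lt_succ_iff_lt_or_eq.1 hi with h | rfl
      · simpa [Function.update_of_ne h.ne] using h1 i h
      · simp
    · rcases Nat.lt_succ_iff_lt_or_eq.1 hi with h | rfl
      · simpa [Function.update_of_ne h.ne] using h2 i h
      · simp
    · rcases Nat.lt_succ_iff_lt_or_eq.1 hi with h | rfl
      · have h0 : 0 ≠ j := by omega
        simpa [Function.update_of_ne h.ne, Function.update_of_ne h0] using h3 i h
      · simp

/-! ### Merging two sorted runs -/

/-- State of merging the runs `[lo, mid)` and `[mid, hi)` of `s` by the key `κ`: the cells `[lo, p)`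
and `[mid, q)` of `s` have been moved to the cells `[lo, o)` of `d`, which are sorted, and no key
there exceeds a key still to be moved. -/
structure Merged (κ : ℕ → ℝ) (s : ℕ → ℕ) (lo mid hi p q o : ℕ) (d : ℕ → ℕ) : Prop where
  lo_le : lo ≤ p
  le_mid : p ≤ mid
  mid_le : mid ≤ q
  le_hi : q ≤ hi
  pos : o + mid = p + q
  sorted : ∀ i j, lo ≤ i → i ≤ j → j < o → κ (d i) ≤ κ (d j)
  le_left : ∀ i j, lo ≤ i → i < o → p ≤ j → j < mid → κ (d i) ≤ κ (s j)
  le_right : ∀ i j, lo ≤ i → i < o → q ≤ j → j < hi → κ (d i) ≤ κ (s j)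
  moved : ∀ j, (lo ≤ j ∧ j < p) ∨ (mid ≤ j ∧ j < q) → ∃ i, lo ≤ i ∧ i < o ∧ d i = s j

section Merge

variable {κ : ℕ → ℝ} {s d : ℕ → ℕ} {lo mid hi p q o : ℕ}

theorem Merged.left (h : Merged κ s lo mid hi p q o d) (hp : p < mid)
    (hs : ∀ j, p ≤ j → j < mid → κ (s p) ≤ κ (s j))
    (hs' : ∀ j, q ≤ j → j < hi → κ (s p) ≤ κ (s j)) :
    Merged κ s lo mid hi (p + 1) q (o + 1) (Function.update d o (s p)) := by
  obtain ⟨h1, h2, h3, h4, h5, h6, h7, h8, h9⟩ := h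
  refine ⟨by omega, by omega, h3, h4, by omega, fun i j hi hij hj => ?_,
    fun i j hi hio hj hj' => ?_, fun i j hi hio hj hj' => ?_, fun j hj => ?_⟩
  · rcases Nat.lt_succ_iff_lt_or_eq.1 hj with h | rfl
    · rw [Function.update_of_ne (by omega), Function.update_of_ne (by omega)]
      exact h6 i j hi hij h
    · rcases hij.lt_or_eq with h | rfl
      · rw [Function.update_of_ne (by omega), Function.update_self]
        exact h7 i p hi h le_rfl hp
      · exact le_rfl
  · rcases Nat.lt_succ_iff_lt_or_eq.1 hio with h | rfl
    · rw [Function.update_of_ne (by omega)]; exact h7 i j hi h (by omega) hj'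
    · rw [Function.update_self]; exact hs j (by omega) hj'
  · rcases Nat.lt_succ_iff_lt_or_eq.1 hio with h | rfl
    · rw [Function.update_of_ne (by omega)]; exact h8 i j hi h hj hj'
    · rw [Function.update_self]; exact hs' j hj hj'
  · by_cases hjp : j = p
    · exact ⟨o, by omega, by omega, by rw [Function.update_self, hjp]⟩
    · obtain ⟨i, hi, hio, hij⟩ := h9 j (by omega)
      exact ⟨i, hi, by omega, by rw [Function.update_of_ne (by omega), hij]⟩

theorem Merged.right (h : Merged κ s lo mid hi p q o d) (hq : q < hi)
    (hs : ∀ j, p ≤ j → j < mid → κ (s q) ≤ κ (s j))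
    (hs' : ∀ j, q ≤ j → j < hi → κ (s q) ≤ κ (s j)) :
    Merged κ s lo mid hi p (q + 1) (o + 1) (Function.update d o (s q)) := by
  obtain ⟨h1, h2, h3, h4, h5, h6, h7, h8, h9⟩ := h
  refine ⟨h1, h2, by omega, by omega, by omega, fun i j hi hij hj => ?_,
    fun i j hi hio hj hj' => ?_, fun i j hi hio hj hj' => ?_, fun j hj => ?_⟩
  · rcases Nat.lt_succ_iff_lt_or_eq.1 hj with h | rfl
    · rw [Function.update_of_ne (by omega), Function.update_of_ne (by omega)]
      exact h6 i j hi hij h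
    · rcases hij.lt_or_eq with h | rfl
      · rw [Function.update_of_ne (by omega), Function.update_self]
        exact h8 i q hi h le_rfl hq
      · exact le_rfl
  · rcases Nat.lt_succ_iff_lt_or_eq.1 hio with h | rfl
    · rw [Function.update_of_ne (by omega)]; exact h7 i j hi h hj hj'
    · rw [Function.update_self]; exact hs j hj hj'
  · rcases Nat.lt_succ_iff_lt_or_eq.1 hio with h | rfl
    · rw [Function.update_of_ne (by omega)]; exact h8 i j hi h (by omega) hj'
    · rw [Function.update_self]; exact hs' j (by omega) hj'
  · by_cases hjq : j = q
    · exact ⟨o, by omega, by omega, by rw [Function.update_self, hjq]⟩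
    · obtain ⟨i, hi, hio, hij⟩ := h9 j (by omega)
      exact ⟨i, hi, by omega, by rw [Function.update_of_ne (by omega), hij]⟩

end Merge

/-- The first coordinate of the point whose index is stored in cell `e` of the index array `1`. -/
abbrev keyExpr (e : NatExpr) : RealExpr := .get 0 (.add (.get 1 e) (.get 1 e))

/-- Is the next element to be taken from the left run? -/
abbrev takeLeft : Test :=
  .and (.natLt (.reg 5) (.reg 6))
    (.not (.and (.natLt (.reg 7) (.reg 8))
      (.not (.realLe (keyExpr (.reg 5)) (keyExpr (.reg 7))))))

/-- Move one element from the index array `1` to cell number `reg 9` of the index array `2`. -/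
abbrev mergeStep : Prog :=
  .seq (.ite takeLeft
      (.seq (.putNat 2 (.reg 9) (.get 1 (.reg 5))) (.incr 5))
      (.seq (.putNat 2 (.reg 9) (.get 1 (.reg 7))) (.incr 7)))
    (.incr 9)

/-- Merge the runs of length `reg 3` which start at `reg 4` and `reg 4 + reg 3`, or what of these
runs lies within the first `reg 1` cells.  The runs are `[reg 5, reg 6)` and `[reg 7, reg 8)`. -/
abbrev mergeBlock : Prog :=
  .seq (.seq (.setNat 5 (.reg 4))
    (.seq (.ite (.natLe (.add (.reg 4) (.reg 3)) (.reg 1))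
      (.setNat 6 (.add (.reg 4) (.reg 3))) (.setNat 6 (.reg 1)))
    (.seq (.setNat 7 (.reg 6))
    (.seq (.ite (.natLe (.add (.reg 6) (.reg 3)) (.reg 1))
      (.setNat 8 (.add (.reg 6) (.reg 3))) (.setNat 8 (.reg 1)))
    (.setNat 9 (.reg 4))))))
  (.seq (.while (.natLt (.reg 9) (.reg 8)) mergeStep)
    (.setNat 4 (.add (.add (.reg 4) (.reg 3)) (.reg 3))))

/-- The first `n` entries of `s` are sorted by the key `κ` within every block of `w` consecutive
cells that starts at a multiple of `w`. -/
def SortedBlocks (κ : ℕ → ℝ) (n w : ℕ) (s : ℕ → ℕ) : Prop :=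
  ∀ b, w ∣ b → ∀ i j, b ≤ i → i ≤ j → j < b + w → j < n → κ (s i) ≤ κ (s j)

theorem run_mergeLoop {σ₀ : Store} {κ : ℕ → ℝ} {s : ℕ → ℕ} {lo mid hi : ℕ}
    (hs : σ₀.natArr 1 = s) (hκ : ∀ v, σ₀.realArr 0 (v + v) = κ v) (h4 : σ₀.natReg 9 = lo)
    (h5 : σ₀.natReg 5 = lo) (h6 : σ₀.natReg 6 = mid) (h7 : σ₀.natReg 7 = mid)
    (h8 : σ₀.natReg 8 = hi) (hlm : lo ≤ mid) (hmh : mid ≤ hi)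
    (hl : ∀ i j, lo ≤ i → i ≤ j → j < mid → κ (s i) ≤ κ (s j))
    (hr : ∀ i j, mid ≤ i → i ≤ j → j < hi → κ (s i) ≤ κ (s j)) :
    Run (.while (.natLt (.reg 9) (.reg 8)) mergeStep) σ₀ (50 * (hi - lo) + 6) (fun τ =>
      (∀ i < lo, τ.natArr 2 i = σ₀.natArr 2 i) ∧
      (∀ i j, lo ≤ i → i ≤ j → j < hi → κ (τ.natArr 2 i) ≤ κ (τ.natArr 2 j)) ∧
      (∀ j, lo ≤ j → j < hi → ∃ i, lo ≤ i ∧ i < hi ∧ τ.natArr 2 i = s j)) := by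
  refine (Run.while (σ₀ := σ₀) (I := fun σ =>
      Merged κ s lo mid hi (σ.natReg 5) (σ.natReg 7) (σ.natReg 9) (σ.natArr 2) ∧
      ∀ i < lo, σ.natArr 2 i = σ₀.natArr 2 i)
    (Φ := fun σ => 50 * (hi - σ.natReg 9)) ?_ ?_).mono ?_ ?_
  · rintro σ hF ⟨hM, hlow⟩ hb
    have hσ6 : σ.natReg 6 = mid := (hF.natReg 6 rfl).trans h6
    have hσ8 : σ.natReg 8 = hi := (hF.natReg 8 rfl).trans h8
    have hσs : σ.natArr 1 = s := (hF.natArr 1 rfl).trans hs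
    have hσκ : ∀ v, σ.realArr 0 (v + v) = κ v := by
      rw [hF.realArr 0 rfl]; exact hκ
    have hlt : σ.natReg 9 < hi := by
      have : σ.natReg 9 + 1 ≤ σ.natReg 8 := hb
      omega
    set p := σ.natReg 5 with hp
    set q := σ.natReg 7 with hq
    set o := σ.natReg 9 with ho
    have h1 := hM.lo_le
    have h2 := hM.le_mid
    have h3 := hM.mid_le
    have h4' := hM.pos
    refine ⟨44, .of_wp (by decide) ⟨fun hb => ?_, fun hb => ?_⟩⟩
    · simp only [Test.Holds, NatExpr.eval, RealExpr.eval, hσs, hσκ, hσ6, hσ8, ← hp, ← hq,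
        not_and, not_not] at hb
      have hstep := hM.left hb.1 (fun j hj hj' => hl p j h1 hj hj')
        (fun j hj hj' => (hb.2 (by omega)).trans (hr q j h3 hj hj'))
      simp only [Prog.wp, NatExpr.eval, Store.setNat_natReg, Store.setNat_natArr,
        Store.putNat_natReg, Store.putNat_natArr, if_true, Nat.reduceEqDiff, if_false, hσs,
        ← hp, ← hq, ← ho, Test.cost, NatExpr.cost]
      refine ⟨⟨hstep, fun i hi => ?_⟩, by omega⟩
      rw [Function.update_of_ne (by omega)]; exact hlow i hi
    · simp only [Test.Holds, NatExpr.eval, RealExpr.eval, hσs, hσκ, hσ6, hσ8, ← hp, ← hq,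
        not_and, not_not] at hb
      have hqhi : q < hi := by
        by_contra hcon
        exact hb (by omega) (fun h => absurd h hcon)
      have hstep := hM.right hqhi
        (fun j hj hj' => by
          have hpq : ¬ κ (s p) ≤ κ (s q) := fun h => hb (by omega) fun _ => h
          exact (le_of_not_ge hpq).trans (hl p j h1 hj hj'))
        (fun j hj hj' => hr q j h3 hj hj')
      simp only [Prog.wp, NatExpr.eval, Store.setNat_natReg, Store.setNat_natArr,
        Store.putNat_natReg, Store.putNat_natArr, if_true, Nat.reduceEqDiff, if_false, hσs,
        ← hp, ← hq, ← ho, Test.cost, NatExpr.cost]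
      refine ⟨⟨hstep, fun i hi => ?_⟩, by omega⟩
      rw [Function.update_of_ne (by omega)]; exact hlow i hi
  · rw [h4, h5, h7]
    exact ⟨⟨le_rfl, hlm, le_rfl, hmh, by omega, by omega, by omega, by omega, by omega⟩,
      fun _ _ => rfl⟩
  · simp [Test.cost, NatExpr.cost, h4]
  · rintro τ ⟨⟨hM, hlow⟩, hb, hF⟩
    have hτ8 : τ.natReg 8 = hi := (hF.natReg 8 rfl).trans h8
    have hb : ¬ τ.natReg 9 + 1 ≤ τ.natReg 8 := hb
    have h1 := hM.pos
    have h2 := hM.le_mid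
    have h3 := hM.le_hi
    have ho : τ.natReg 9 = hi := by omega
    refine ⟨hlow, fun i j hi hij hj => hM.sorted i j hi hij (by omega), fun j hj hj' => ?_⟩
    obtain ⟨i, hi, hio, hij⟩ := hM.moved j (by omega)
    exact ⟨i, hi, by omega, hij⟩

theorem run_mergeBlock {σ₀ : Store} {κ : ℕ → ℝ} {s : ℕ → ℕ} {n w lo : ℕ}
    (hs : σ₀.natArr 1 = s) (hκ : ∀ v, σ₀.realArr 0 (v + v) = κ v) (hn : σ₀.natReg 1 = n)
    (hw : σ₀.natReg 3 = w) (hlo : σ₀.natReg 4 = lo) (hlon : lo < n) (hdvd : w ∣ lo)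
    (hw0 : 0 < w) (hsb : SortedBlocks κ n w s) :
    Run mergeBlock σ₀ (100 * ((n - lo) - (n - (lo + w + w)))) (fun τ =>
      τ.natReg 4 = lo + w + w ∧ (∀ i < lo, τ.natArr 2 i = σ₀.natArr 2 i) ∧
      (∀ i j, lo ≤ i → i ≤ j → j < lo + w + w → j < n → κ (τ.natArr 2 i) ≤ κ (τ.natArr 2 j)) ∧
      (∀ j, lo ≤ j → j < lo + w + w → j < n → ∃ i, i < lo + w + w ∧ i < n ∧
        τ.natArr 2 i = s j)) := by
  obtain ⟨mid, hmid⟩ : ∃ mid, mid = min (lo + w) n := ⟨_, rfl⟩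
  obtain ⟨hi, hhi⟩ : ∃ hi, hi = min (mid + w) n := ⟨_, rfl⟩
  have hl : ∀ i j, lo ≤ i → i ≤ j → j < mid → κ (s i) ≤ κ (s j) := fun i j h1 h2 h3 =>
    hsb lo hdvd i j h1 h2 (by omega) (by omega)
  have hr : ∀ i j, mid ≤ i → i ≤ j → j < hi → κ (s i) ≤ κ (s j) := fun i j h1 h2 h3 =>
    hsb (lo + w) (hdvd.add (dvd_refl w)) i j (by omega) h2 (by omega) (by omega)
  have hsetup : Run (.seq (.setNat 5 (.reg 4))
      (.seq (.ite (.natLe (.add (.reg 4) (.reg 3)) (.reg 1))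
        (.setNat 6 (.add (.reg 4) (.reg 3))) (.setNat 6 (.reg 1)))
      (.seq (.setNat 7 (.reg 6))
      (.seq (.ite (.natLe (.add (.reg 6) (.reg 3)) (.reg 1))
        (.setNat 8 (.add (.reg 6) (.reg 3))) (.setNat 8 (.reg 1)))
      (.setNat 9 (.reg 4)))))) σ₀ 38 (fun τ => τ.natReg 5 = lo ∧ τ.natReg 6 = mid ∧
        τ.natReg 7 = mid ∧ τ.natReg 8 = hi ∧ τ.natReg 9 = lo) := by
    refine .of_wp (by decide) ?_
    simp only [Prog.wp, NatExpr.eval, Store.setNat_natReg, Test.Holds, if_true, Nat.reduceEqDiff,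
      if_false, hn, hw, hlo, true_and, and_true]
    refine ⟨fun h1 => ⟨fun h2 => ?_, fun h2 => ?_⟩, fun h1 => ⟨fun h2 => ?_, fun h2 => ?_⟩⟩ <;>
      omega
  refine (Run.seq (T₂ := (50 * (hi - lo) + 6) + 6) hsetup.frame ?_).mono (by omega) fun _ h => h
  · rintro τ ⟨⟨h5, h6, h7, h8, h9⟩, hF⟩
    have hloop := (run_mergeLoop (σ₀ := τ) ((hF.natArr 1 rfl).trans hs)
      (by rw [hF.realArr 0 rfl]; exact hκ) h9 h5 h6 h7 h8 (by omega) (by omega) hl hr).frame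
    refine Run.seq hloop ?_
    rintro υ ⟨⟨hlow, hsort, hmov⟩, hF'⟩
    have h3 : υ.natReg 3 = w := (hF'.natReg 3 rfl).trans ((hF.natReg 3 rfl).trans hw)
    have h4 : υ.natReg 4 = lo := (hF'.natReg 4 rfl).trans ((hF.natReg 4 rfl).trans hlo)
    refine .of_wp le_rfl ?_
    simp only [Prog.wp, NatExpr.eval, Store.setNat_natReg, Store.setNat_natArr, if_true, h3, h4,
      true_and]
    refine ⟨fun i hi => (hlow i hi).trans (by rw [hF.natArr 2 rfl]),
      fun i j h1 h2 h3 h4 => hsort i j h1 h2 (by omega), fun j h1 h2 h3 => ?_⟩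
    obtain ⟨i, -, hi, hij⟩ := hmov j h1 (by omega)
    exact ⟨i, by omega, by omega, hij⟩

/-! ### Bottom-up merge sort -/

/-- Merge all runs of length `reg 3` in pairs and copy the result back to the index array `1`. -/
abbrev mergePass : Prog :=
  .seq (.seq (.setNat 4 (.const 0)) (.while (.natLt (.reg 4) (.reg 1)) mergeBlock))
    (.forRange 4 1 (.putNat 1 (.reg 4) (.get 2 (.reg 4))))

theorem run_mergePass {σ₀ : Store} {κ : ℕ → ℝ} {s : ℕ → ℕ} {n w : ℕ}
    (hs : σ₀.natArr 1 = s) (hκ : ∀ v, σ₀.realArr 0 (v + v) = κ v) (hn : σ₀.natReg 1 = n)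
    (hw : σ₀.natReg 3 = w) (hw0 : 0 < w) (hsb : SortedBlocks κ n w s) :
    Run mergePass σ₀ (130 * n + 20) (fun τ =>
      SortedBlocks κ n (w + w) (τ.natArr 1) ∧ ∀ j < n, ∃ i < n, τ.natArr 1 i = s j) := by
  have hmerge : Run (.seq (.setNat 4 (.const 0)) (.while (.natLt (.reg 4) (.reg 1)) mergeBlock))
      σ₀ (2 + (110 * n + 6)) (fun τ =>
        SortedBlocks κ n (w + w) (τ.natArr 2) ∧ ∀ j < n, ∃ i < n, τ.natArr 2 i = s j) := by
    refine Run.seq (Q₁ := fun τ => τ = σ₀.setNat 4 0) (.of_wp le_rfl rfl) ?_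
    rintro _ rfl
    refine (Run.while (σ₀ := σ₀.setNat 4 0) (I := fun σ => (w + w) ∣ σ.natReg 4 ∧
        (∀ b, (w + w) ∣ b → b < σ.natReg 4 → ∀ i j, b ≤ i → i ≤ j → j < b + (w + w) → j < n →
          κ (σ.natArr 2 i) ≤ κ (σ.natArr 2 j)) ∧
        ∀ j < n, j < σ.natReg 4 → ∃ i < n, i < σ.natReg 4 ∧ σ.natArr 2 i = s j)
      (Φ := fun σ => 110 * (n - σ.natReg 4)) ?_ ?_).mono ?_ ?_
    · rintro σ hF ⟨hdvd, hsort, hmov⟩ hb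
      have hσn : σ.natReg 1 = n := (hF.natReg 1 rfl).trans hn
      have hlt : σ.natReg 4 < n := by
        have : σ.natReg 4 + 1 ≤ σ.natReg 1 := hb
        omega
      refine ⟨_, (run_mergeBlock ((hF.natArr 1 rfl).trans hs)
        (by rw [hF.realArr 0 rfl]; exact hκ) hσn ((hF.natReg 3 rfl).trans hw) rfl hlt
        ((Dvd.intro 2 (by ring)).trans hdvd) hw0 hsb).mono le_rfl ?_⟩
      rintro τ ⟨h4, hlow, hsort', hmov'⟩
      rw [h4]
      refine ⟨⟨?_, ?_, ?_⟩, ?_⟩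
      · rw [add_assoc]; exact hdvd.add (dvd_refl _)
      · intro b hb hb4 i j hbi hij hjb hjn
        -- distinct multiples of `w + w` are at least `w + w` apart
        have hcase : b + (w + w) ≤ σ.natReg 4 ∨ b = σ.natReg 4 := by
          obtain ⟨x, rfl⟩ := hb
          obtain ⟨y, hy⟩ := hdvd
          rw [hy, add_assoc, ← Nat.mul_add_one] at hb4
          have hxy : x < y + 1 := lt_of_mul_lt_mul_left hb4 (Nat.zero_le _)
          rcases Nat.lt_succ_iff_lt_or_eq.1 hxy with h | h
          · left
            rw [hy, ← Nat.mul_add_one]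
            exact Nat.mul_le_mul_left _ h
          · right
            rw [hy, h]
        rcases hcase with h | rfl
        · rw [hlow i (by omega), hlow j (by omega)]
          exact hsort b hb (by omega) i j hbi hij hjb hjn
        · exact hsort' i j hbi hij (by omega) hjn
      · intro j hjn hj
        rcases lt_or_ge j (σ.natReg 4) with h | h
        · obtain ⟨i, hi, hi4, hij⟩ := hmov j hjn h
          exact ⟨i, hi, by omega, by rw [hlow i hi4, hij]⟩
        · obtain ⟨i, h1, h2, h3⟩ := hmov' j h hj hjn
          exact ⟨i, h2, h1, h3⟩
      · simp only [Test.cost, NatExpr.cost]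
        omega
    · simp
    · simp [Test.cost, NatExpr.cost]
    · rintro τ ⟨⟨-, hsort, hmov⟩, hb, hF⟩
      have hτn : τ.natReg 1 = n := (hF.natReg 1 rfl).trans hn
      have hb : ¬ τ.natReg 4 + 1 ≤ τ.natReg 1 := hb
      refine ⟨fun b hb i j hbi hij hjb hjn => hsort b hb (by omega) i j hbi hij hjb hjn,
        fun j hj => ?_⟩
      obtain ⟨i, hi, -, hij⟩ := hmov j hj (by omega)
      exact ⟨i, hi, hij⟩
  refine (Run.seq (T₂ := n * (4 + 10) + 8) hmerge.frame ?_).mono (by omega) fun _ h => h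
  rintro τ ⟨⟨hsort, hmov⟩, hF⟩
  have hτn : τ.natReg 1 = n := (hF.natReg 1 rfl).trans hn
  have hcopy := Run.forRange (i := 4) (n := 1) (p := .putNat 1 (.reg 4) (.get 2 (.reg 4)))
    (σ₀ := τ) (I := fun m σ => ∀ i < m, σ.natArr 1 i = τ.natArr 2 i) 4 rfl rfl (by decide)
    (by simp) (by
      rintro j - σ hF' hj hI
      refine .of_wp le_rfl ?_
      simp only [Prog.wp, NatExpr.eval, Store.setNat_natArr, Store.putNat_natArr, if_true, hj]
      intro i hi
      rcases Nat.lt_succ_iff_lt_or_eq.1 hi with h | rfl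
      · rw [Function.update_of_ne h.ne]; exact hI i h
      · rw [Function.update_self, hF'.natArr 2 rfl])
  rw [hτn] at hcopy
  refine hcopy.mono le_rfl ?_
  rintro υ ⟨hcp, -⟩
  refine ⟨fun b hb i j hbi hij hjb hjn => ?_, fun j hj => ?_⟩
  · rw [hcp i (by omega), hcp j hjn]
    exact hsort b hb i j hbi hij hjb hjn
  · obtain ⟨i, hi, hij⟩ := hmov j hj
    exact ⟨i, hi, (hcp i hi).trans hij⟩

/-- Sort the indices `0, …, reg 1 - 1` by the first coordinate of the points. -/
abbrev sortProg : Prog :=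
  .seq (.forRange 4 1 (.putNat 1 (.reg 4) (.reg 4)))
    (.seq (.setNat 3 (.const 1))
      (.while (.natLt (.reg 3) (.reg 1))
        (.seq mergePass (.setNat 3 (.add (.reg 3) (.reg 3))))))

theorem run_sortProg {σ₀ : Store} {κ : ℕ → ℝ} {n : ℕ} (hn : σ₀.natReg 1 = n) (hn0 : 0 < n)
    (hκ : ∀ v, σ₀.realArr 0 (v + v) = κ v) :
    Run sortProg σ₀ (160 * n * Nat.clog 2 n + 40 * n) (fun τ =>
      (∀ i j, i ≤ j → j < n → κ (τ.natArr 1 i) ≤ κ (τ.natArr 1 j)) ∧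
      ∀ v < n, ∃ i < n, τ.natArr 1 i = v) := by
  have hinit := Run.forRange (i := 4) (n := 1) (p := .putNat 1 (.reg 4) (.reg 4))
    (σ₀ := σ₀) (I := fun m σ => ∀ i < m, σ.natArr 1 i = i) 3 rfl rfl (by decide)
    (by simp) (by
      rintro j - σ - hj hI
      refine .of_wp le_rfl ?_
      simp only [Prog.wp, NatExpr.eval, Store.setNat_natArr, Store.putNat_natArr, if_true, hj]
      intro i hi
      rcases Nat.lt_succ_iff_lt_or_eq.1 hi with h | rfl
      · rw [Function.update_of_ne h.ne]; exact hI i h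
      · rw [Function.update_self])
  rw [hn] at hinit
  refine (Run.seq (T₂ := 2 + (160 * n * Nat.clog 2 n + 6)) hinit ?_).mono
    (by omega) fun _ h => h
  rintro τ ⟨hid, hF⟩
  have hτn : τ.natReg 1 = n := (hF.natReg 1 rfl).trans hn
  refine Run.seq (Q₁ := fun υ => υ = τ.setNat 3 1) (.of_wp le_rfl rfl) ?_
  rintro _ rfl
  refine (Run.while (σ₀ := τ.setNat 3 1) (I := fun σ => 0 < σ.natReg 3 ∧
      SortedBlocks κ n (σ.natReg 3) (σ.natArr 1) ∧ ∀ v < n, ∃ i < n, σ.natArr 1 i = v)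
    (Φ := fun σ => 160 * n * (Nat.clog 2 n - Nat.log 2 (σ.natReg 3))) ?_ ?_).mono ?_ ?_
  · rintro σ hF' ⟨hw0, hsort, hcov⟩ hb
    have hσn : σ.natReg 1 = n := (hF'.natReg 1 rfl).trans hτn
    have hσκ : ∀ v, σ.realArr 0 (v + v) = κ v := by
      rw [hF'.realArr 0 rfl]
      intro v
      rw [Store.setNat_realArr, hF.realArr 0 rfl, hκ]
    have hlt : σ.natReg 3 < n := by
      have : σ.natReg 3 + 1 ≤ σ.natReg 1 := hb
      omega
    refine ⟨_, Run.seq (T₂ := 4) (run_mergePass rfl hσκ hσn rfl hw0 hsort).frame ?_⟩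
    rintro υ ⟨⟨hsort', hcov'⟩, hF''⟩
    have hυ3 : υ.natReg 3 = σ.natReg 3 := hF''.natReg 3 rfl
    refine .of_wp le_rfl ?_
    simp only [Prog.wp, NatExpr.eval, Store.setNat_natReg, Store.setNat_natArr, if_true, hυ3]
    refine ⟨⟨by omega, hsort', fun v hv => ?_⟩, ?_⟩
    · obtain ⟨j, hj, hjv⟩ := hcov v hv
      obtain ⟨i, hi, hij⟩ := hcov' j hj
      exact ⟨i, hi, hij.trans hjv⟩
    · have hlog : Nat.log 2 (σ.natReg 3 + σ.natReg 3) = Nat.log 2 (σ.natReg 3) + 1 := by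
        rw [← Nat.mul_two, Nat.log_mul_base one_lt_two hw0.ne']
      have hlog' : Nat.log 2 (σ.natReg 3) < Nat.clog 2 n :=
        Nat.log_lt_of_lt_pow hw0.ne' (hlt.trans_le (Nat.le_pow_clog one_lt_two n))
      obtain ⟨m, hm⟩ : ∃ m, Nat.clog 2 n - Nat.log 2 (σ.natReg 3) = m + 1 :=
        ⟨Nat.clog 2 n - Nat.log 2 (σ.natReg 3) - 1, by omega⟩
      rw [hlog, hm, show Nat.clog 2 n - (Nat.log 2 (σ.natReg 3) + 1) = m by omega, Nat.mul_add_one]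
      simp only [Test.cost, NatExpr.cost]
      omega
  · refine ⟨by simp, fun b _ i j hbi hij hjb hjn => ?_, fun v hv => ⟨v, hv, ?_⟩⟩
    · simp only [Store.setNat_natReg, if_true] at hjb
      rw [show i = j by omega]
    · simpa using hid v hv
  · simp [Test.cost, NatExpr.cost]
  · rintro υ ⟨⟨-, hsort, hcov⟩, hb, hF'⟩
    have hυn : υ.natReg 1 = n := (hF'.natReg 1 rfl).trans hτn
    have hb : ¬ υ.natReg 3 + 1 ≤ υ.natReg 1 := hb
    exact ⟨fun i j hij hj => hsort 0 (dvd_zero _) i j (Nat.zero_le i) hij (by omega) hj, hcov⟩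

/-! ### Placing the centers -/

/-- One round of the greedy choice: the center `reg 6` is the last position up to `reg 4` that
covers the first uncovered position `reg 5`, which then moves to the first position up to
`reg 4 + 1` that the new center does not cover. -/
abbrev greedyRound : Prog :=
  .seq (.setNat 6 (.reg 5))
  (.seq (.while (.and (.natLt (.reg 6) (.reg 4))
      (.realLe (.sub (.get 2 (.add (.reg 6) (.const 1))) (.get 2 (.reg 5))) (.get 4 (.reg 1))))
    (.incr 6))
  (.seq (.setNat 5 (.add (.reg 6) (.const 1)))
  (.seq (.while (.and (.natLe (.reg 5) (.reg 4))
      (.realLe (.sub (.get 1 (.reg 5)) (.get 1 (.reg 6))) (.get 4 (.reg 1))))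
    (.incr 5))
  (.seq (.putNat 0 (.reg 3) (.get 1 (.reg 6)))
    (.incr 4)))))

/-- Choose `reg 2` centers greedily, for the radius in cell `reg 1` of the real array `4`.  Register
`4` is the last position that leaves enough positions for the centers of the later rounds, so that
exactly `reg 2` different centers are chosen. -/
abbrev greedyProg : Prog :=
  .seq (.setNat 5 (.const 0))
    (.seq (.setNat 4 (.sub (.reg 1) (.reg 2))) (.forRange 3 2 greedyRound))

theorem run_greedyRound {σ₀ : Store} {n a h r : ℕ} {x u : ℕ → ℝ} {v : ℝ} {s : ℕ → ℕ}
    (hx : σ₀.realArr 1 = x) (hu : σ₀.realArr 2 = u) (hv : σ₀.realArr 4 (σ₀.natReg 1) = v)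
    (hs : σ₀.natArr 1 = s) (ha : σ₀.natReg 5 = a) (hh : σ₀.natReg 4 = h) (hr : σ₀.natReg 3 = r)
    (hv0 : 0 ≤ v) (hah : a ≤ h) (hhn : h < n) :
    Run greedyRound σ₀ (60 * n + 40) (fun τ => ∃ c a', a ≤ c ∧ c < a' ∧ a' ≤ h + 1 ∧
      u c - u a ≤ v ∧ x (a' - 1) - x c ≤ v ∧ (c < h → v < u (c + 1) - u a) ∧
      (a' ≤ h → v < x a' - x c) ∧ τ.natReg 5 = a' ∧ τ.natReg 4 = h + 1 ∧
      τ.natArr 0 = Function.update (σ₀.natArr 0) r (s c)) := by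
  refine (Run.seq (T₁ := 2) (T₂ := 30 * n + 18 + (4 + (30 * n + 7 + 8)))
    (Q₁ := fun τ => τ = σ₀.setNat 6 a) (.of_wp le_rfl (by simp [Prog.wp, NatExpr.eval, ha]))
    ?_).mono (by omega) fun _ h => h
  rintro _ rfl
  refine Run.seq (Q₁ := fun τ => ∃ c, a ≤ c ∧ c ≤ h ∧ u c - u a ≤ v ∧
    (c < h → v < u (c + 1) - u a) ∧ τ = σ₀.setNat 6 c) ?_ ?_
  · refine (Run.while (σ₀ := σ₀.setNat 6 a) (I := fun σ => ∃ c, a ≤ c ∧ c ≤ h ∧ u c - u a ≤ v ∧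
      σ = σ₀.setNat 6 c) (Φ := fun σ => 30 * (h - σ.natReg 6)) ?_ ?_).mono ?_ ?_
    · rintro _ - ⟨c, hac, hch, huc, rfl⟩ hb
      simp only [Test.Holds, NatExpr.eval, RealExpr.eval, Store.setNat_natReg,
        Store.setNat_realArr, if_true, Nat.reduceEqDiff, if_false, hh, hu, ha, hv] at hb
      refine ⟨4, .of_wp le_rfl ?_⟩
      simp only [Prog.wp, NatExpr.eval, Store.setNat_natReg, if_true, Test.cost, NatExpr.cost,
        RealExpr.cost]
      refine ⟨⟨c + 1, by omega, hb.1, hb.2, ?_⟩, by omega⟩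
      simp [Store.setNat]
    · exact ⟨a, le_rfl, hah, by simpa using hv0, rfl⟩
    · simp [Test.cost, NatExpr.cost, RealExpr.cost]; omega
    · rintro _ ⟨⟨c, hac, hch, huc, rfl⟩, hb, -⟩
      simp only [Test.Holds, NatExpr.eval, RealExpr.eval, Store.setNat_natReg,
        Store.setNat_realArr, if_true, Nat.reduceEqDiff, if_false, hh, hu, ha, hv, not_and,
        not_le] at hb
      exact ⟨c, hac, hch, huc, hb, rfl⟩
  rintro _ ⟨c, hac, hch, huc, hu_far, rfl⟩
  refine Run.seq (Q₁ := fun τ => τ = (σ₀.setNat 6 c).setNat 5 (c + 1)) (.of_wp le_rfl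
    (by simp [Prog.wp, NatExpr.eval])) ?_
  rintro _ rfl
  refine Run.seq (T₂ := 8) (Q₁ := fun τ => ∃ a', c < a' ∧ a' ≤ h + 1 ∧ x (a' - 1) - x c ≤ v ∧
    (a' ≤ h → v < x a' - x c) ∧ τ = (σ₀.setNat 6 c).setNat 5 a') ?_ ?_
  · refine (Run.while (σ₀ := (σ₀.setNat 6 c).setNat 5 (c + 1)) (I := fun σ => ∃ a', c < a' ∧
      a' ≤ h + 1 ∧ x (a' - 1) - x c ≤ v ∧ σ = (σ₀.setNat 6 c).setNat 5 a')
      (Φ := fun σ => 30 * (h + 1 - σ.natReg 5)) ?_ ?_).mono ?_ ?_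
    · rintro _ - ⟨a', hca, hah', hxa, rfl⟩ hb
      simp only [Test.Holds, NatExpr.eval, RealExpr.eval, Store.setNat_natReg,
        Store.setNat_realArr, if_true, Nat.reduceEqDiff, if_false, hh, hx, hv] at hb
      refine ⟨4, .of_wp le_rfl ?_⟩
      simp only [Prog.wp, NatExpr.eval, Store.setNat_natReg, if_true, Test.cost, NatExpr.cost,
        RealExpr.cost]
      refine ⟨⟨a' + 1, by omega, by omega, hb.2, ?_⟩, by omega⟩
      simp [Store.setNat]
    · exact ⟨c + 1, by omega, by omega, by simpa using hv0, rfl⟩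
    · simp [Test.cost, NatExpr.cost, RealExpr.cost]; omega
    · rintro _ ⟨⟨a', hca, hah', hxa, rfl⟩, hb, -⟩
      simp only [Test.Holds, NatExpr.eval, RealExpr.eval, Store.setNat_natReg,
        Store.setNat_realArr, if_true, Nat.reduceEqDiff, if_false, hh, hx, hv, not_and,
        not_le] at hb
      exact ⟨a', hca, hah', hxa, hb, rfl⟩
  rintro _ ⟨a', hca, hah', hxa, hx_far, rfl⟩
  refine .of_wp le_rfl ?_
  simp only [Prog.wp, NatExpr.eval, Store.setNat_natReg, Store.setNat_natArr,
    Store.putNat_natReg, Store.putNat_natArr, if_true, Nat.reduceEqDiff, if_false, hs, hh, hr]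
  exact ⟨c, a', hac, hca, hah', huc, hxa, hu_far, hx_far, by trivial, by trivial, by trivial⟩

theorem run_greedyProg {σ₀ : Store} {n k : ℕ} {x u : ℕ → ℝ} {v : ℝ} {s : ℕ → ℕ}
    (hxσ : σ₀.realArr 1 = x) (huσ : σ₀.realArr 2 = u) (hvσ : σ₀.realArr 4 n = v)
    (hs : σ₀.natArr 1 = s) (hn : σ₀.natReg 1 = n) (hk : σ₀.natReg 2 = k) (hkn : k ≤ n)
    (hx : MonotoneOn x (Set.Iio n)) (hu : MonotoneOn u (Set.Iio n)) (hv0 : 0 ≤ v)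
    (hreach : Reach x u v k n) :
    Run greedyProg σ₀ (k * (60 * n + 50) + 14) (fun τ => ∃ cs : ℕ → ℕ,
      (∀ j < k, cs j < n ∧ τ.natArr 0 j = s (cs j)) ∧
      (∀ i j, i < j → j < k → cs i < cs j) ∧
      ∀ i < n, ∃ j < k, (i ≤ cs j ∧ u (cs j) - u i ≤ v) ∨ (cs j ≤ i ∧ x i - x (cs j) ≤ v)) := by
  have hx' : ∀ i j, i ≤ j → j < n → x i ≤ x j := fun i j h hj =>
    hx (show i < n by omega) hj h
  have hu' : ∀ i j, i ≤ j → j < n → u i ≤ u j := fun i j h hj =>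
    hu (show i < n by omega) hj h
  refine (Run.seq (T₁ := 2) (T₂ := 4 + (k * (60 * n + 50) + 8))
    (Q₁ := fun τ => τ = σ₀.setNat 5 0) (.of_wp le_rfl (by rfl)) ?_).mono (by omega) fun _ h => h
  rintro _ rfl
  refine Run.seq (Q₁ := fun τ => τ = (σ₀.setNat 5 0).setNat 4 (n - k)) (.of_wp le_rfl
    (by simp [Prog.wp, NatExpr.eval, hn, hk])) ?_
  rintro _ rfl
  set σ₁ := (σ₀.setNat 5 0).setNat 4 (n - k) with hσ₁
  have h2 : σ₁.natReg 2 = k := by simpa [hσ₁] using hk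
  have hloop := Run.forRange (i := 3) (n := 2) (p := greedyRound) (σ₀ := σ₁)
    (I := fun m σ => σ.natReg 4 = n - k + m ∧ σ.natReg 5 ≤ n - k + m ∧
      (σ.natReg 5 = n - k + m ∨ ∀ i ≤ n, Reach x u v m i → i ≤ σ.natReg 5) ∧
      ∃ cs : ℕ → ℕ, (∀ j < m, cs j < n ∧ σ.natArr 0 j = s (cs j)) ∧
      (∀ i j, i < j → j < m → cs i < cs j) ∧ (∀ j < m, cs j < σ.natReg 5) ∧
      ∀ i < σ.natReg 5, ∃ j < m,
        (i ≤ cs j ∧ u (cs j) - u i ≤ v) ∨ (cs j ≤ i ∧ x i - x (cs j) ≤ v))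
    (60 * n + 40) rfl rfl (by decide) ?_ ?_
  · rw [h2] at hloop
    refine hloop.mono le_rfl ?_
    rintro τ ⟨⟨-, hle, hmax, cs, h1, h2, -, h4⟩, -⟩
    have hend : τ.natReg 5 = n := by
      rcases hmax with h | h
      · omega
      · have := h n le_rfl hreach
        omega
    rw [hend] at h4
    exact ⟨cs, h1, h2, h4⟩
  · refine ⟨by simp [hσ₁], by simp [hσ₁], Or.inr ?_, fun _ => 0, by omega, by omega, by omega, ?_⟩
    · rintro i - (rfl : i = 0)
      exact Nat.zero_le _
    · simp [hσ₁]
  · rintro m hm σ hF hσm ⟨hσ4, hle, hmax, cs, h1, h2', h3, h4⟩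
    rw [h2] at hm
    have hσn : σ.natReg 1 = n := (hF.natReg 1 rfl).trans (by simpa [hσ₁] using hn)
    have hrun := run_greedyRound (n := n) (v := v) ((hF.realArr 1 rfl).trans hxσ)
      ((hF.realArr 2 rfl).trans huσ) (by rw [hF.realArr 4 rfl, hσn]; exact hvσ)
      ((hF.natArr 1 rfl).trans hs) rfl hσ4 hσm hv0 hle (by omega)
    refine hrun.mono le_rfl ?_
    rintro τ ⟨c, a', hac, hca, hah, huc, hxa, hu_far, hx_far, hτ5, hτ4, hτ0⟩
    set a := σ.natReg 5 with ha
    have hchn : c < n := by omega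
    simp only [Store.setNat_natReg, Store.setNat_natArr, Nat.reduceEqDiff, if_false, hτ5, hτ4, hτ0]
    refine ⟨by omega, by omega, ?_, Function.update cs m c, ?_, ?_, ?_, ?_⟩
    · -- unless it is stopped by its bound, the greedy choice reaches furthest
      by_cases hend : a' = n - k + (m + 1)
      · exact Or.inl hend
      right
      rintro i hi (rfl | ⟨a₀, c₀, hr, hac₀, hci, huc₀, hxi⟩)
      · exact Nat.zero_le _
      have ha₀ : a₀ ≤ a := by
        rcases hmax with h | h
        · omega
        · exact h a₀ (by omega) hr
      have hc₀ : c₀ ≤ c := by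
        by_contra hcon
        have e1 := hu_far (by omega)
        have e2 := hu' a₀ a ha₀ (by omega)
        have e3 := hu' (c + 1) c₀ (by omega) (by omega)
        linarith
      by_contra hcon
      have e1 := hx_far (by omega)
      have e2 := hx' c₀ c hc₀ hchn
      have e3 := hx' a' (i - 1) (by omega) (by omega)
      linarith
    · intro j hj
      rcases Nat.lt_succ_iff_lt_or_eq.1 hj with h | rfl
      · rw [Function.update_of_ne h.ne, Function.update_of_ne h.ne]; exact h1 j h
      · simpa using hchn
    · intro i j hij hj
      rw [Function.update_of_ne (show i ≠ m by omega)]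
      rcases Nat.lt_succ_iff_lt_or_eq.1 hj with h | rfl
      · rw [Function.update_of_ne h.ne]; exact h2' i j hij h
      · rw [Function.update_self]
        have := h3 i hij
        omega
    · intro j hj
      rcases Nat.lt_succ_iff_lt_or_eq.1 hj with h | rfl
      · rw [Function.update_of_ne h.ne]
        have := h3 j h
        omega
      · rwa [Function.update_self]
    · intro i hi
      rcases lt_or_ge i a with h | h
      · obtain ⟨j, hj, hcov⟩ := h4 i h
        exact ⟨j, by omega, by rwa [Function.update_of_ne hj.ne]⟩
      · refine ⟨m, by omega, ?_⟩
        rw [Function.update_self]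
        rcases le_or_gt i c with h' | h'
        · have := hu' a i h (by omega)
          exact Or.inl ⟨h', by linarith⟩
        · have := hx' i (a' - 1) (by omega) (by omega)
          exact Or.inr ⟨h'.le, by linarith⟩

/-! ### Directed coverage of Pareto sets in the plane -/

theorem directedCoverage_le_iff {d : ℕ} {S A : Finset (Fin d → ℝ)} (hS : S.Nonempty)
    (hA : A.Nonempty) (v : ℝ) :
    directedCoverage S A ≤ v ↔ ∀ a ∈ A, ∃ s ∈ S, directedDist a s ≤ v := by
  have : Nonempty S := hS.to_subtype
  have : Nonempty A := hA.to_subtype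
  unfold directedCoverage
  rw [ciSup_le_iff (Set.finite_range _).bddAbove]
  constructor
  · intro h a ha
    obtain ⟨s, hs⟩ := exists_eq_ciInf_of_finite (f := fun s : S => directedDist a (s : Fin d → ℝ))
    exact ⟨s, s.2, hs.trans_le (h ⟨a, ha⟩)⟩
  · rintro h ⟨a, ha⟩
    obtain ⟨s, hs, hv⟩ := h a ha
    exact (ciInf_le (Set.finite_range _).bddBelow (⟨s, hs⟩ : S)).trans hv

theorem directedDist_nonneg {d : ℕ} (a s : Fin d → ℝ) : 0 ≤ directedDist a s :=
  Finset.sum_nonneg fun _ _ => le_max_right _ _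

theorem IsParetoSet.anti {A : Finset (Fin 2 → ℝ)} (hA : IsParetoSet A) {p q : Fin 2 → ℝ}
    (hp : p ∈ A) (hq : q ∈ A) (h : p 0 ≤ q 0) : q 1 ≤ p 1 := by
  by_contra! hlt
  exact hA p hp q hq ⟨Fin.forall_fin_two.2 ⟨h, hlt.le⟩, 1, hlt⟩

theorem directedDist_of_le {A : Finset (Fin 2 → ℝ)} (hA : IsParetoSet A) {p q : Fin 2 → ℝ}
    (hp : p ∈ A) (hq : q ∈ A) (h : p 0 ≤ q 0) : directedDist p q = p 1 - q 1 := by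
  have := hA.anti hp hq h
  simp [directedDist, h, this]

theorem directedDist_of_ge {A : Finset (Fin 2 → ℝ)} (hA : IsParetoSet A) {p q : Fin 2 → ℝ}
    (hp : p ∈ A) (hq : q ∈ A) (h : q 0 ≤ p 0) : directedDist p q = p 0 - q 0 := by
  have := hA.anti hq hp h
  simp [directedDist, h, this]

theorem IsParetoSet.card_le_one {d : ℕ} (hd : d ≤ 1) {A : Finset (Fin d → ℝ)}
    (hA : IsParetoSet A) : A.card ≤ 1 := by
  refine Finset.card_le_one.2 fun p hp q hq => ?_
  interval_cases d
  · exact Subsingleton.elim p q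
  · have key : ∀ p ∈ A, ∀ q ∈ A, p 0 ≤ q 0 := by
      intro p hp q hq
      by_contra! hlt
      exact hA q hq p hp ⟨Fin.forall_fin_one.2 hlt.le, 0, hlt⟩
    funext i
    rw [Fin.fin_one_eq_zero i]
    exact le_antisymm (key p hp q hq) (key q hq p hp)

/-! ### The whole algorithm -/

/-- The algorithm for at most two objectives.  A single point is the only slate; a Pareto set with
more points has two objectives. -/
abbrev pruningProg : Prog :=
  .ite (.natLe (.reg 1) (.const 1)) (.putNat 0 (.const 0) (.const 0))
    (.seq sortProg (.seq fillProg (.seq radiusProg greedyProg)))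

/-- A function that maps `{0, …, n - 1}` onto a superset permutes it. -/
theorem lt_and_injOn_of_cover {n : ℕ} {s : ℕ → ℕ} (h : ∀ v < n, ∃ i < n, s i = v) :
    (∀ i < n, s i < n) ∧ Set.InjOn s (Set.Iio n) := by
  have hsub : Finset.range n ⊆ (Finset.range n).image s := fun v hv => by
    simpa using h v (Finset.mem_range.1 hv)
  have heq := Finset.eq_of_subset_of_card_le hsub Finset.card_image_le
  refine ⟨fun i hi => ?_, ?_⟩
  · rw [← Finset.mem_range, heq]
    exact Finset.mem_image_of_mem s (Finset.mem_range.2 hi)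
  · have hinj := Finset.card_image_iff.1 (congrArg Finset.card heq).symm
    simpa using hinj

/-- What the phases of the algorithm compute, for two objectives. -/
theorem run_twoObjectives {n k : ℕ} (hn : 0 < n) (hk : 0 < k) (hkn : k ≤ n) {z : ℕ → ℝ}
    {σ₀ : Store} (h1 : σ₀.natReg 1 = n) (h2 : σ₀.natReg 2 = k) (hz : σ₀.realArr 0 = z)
    (hanti : ∀ i < n, ∀ j < n, z (i + i) ≤ z (j + j) → z (j + j + 1) ≤ z (i + i + 1)) :
    Run (.seq sortProg (.seq fillProg (.seq radiusProg greedyProg))) σ₀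
      (160 * n * Nat.clog 2 n + 40 * n + (50 * n + 20 + (k * (240 * n + 30) + 8 +
        (k * (60 * n + 50) + 14)))) (fun τ =>
      ∃ (s cs : ℕ → ℕ) (x u : ℕ → ℝ) (v : ℝ),
        (∀ i < n, s i < n) ∧ Set.InjOn s (Set.Iio n) ∧ (∀ w < n, ∃ i < n, s i = w) ∧
        (∀ i < n, x i = z (s i + s i)) ∧ (∀ i < n, u i = -z (s i + s i + 1)) ∧
        MonotoneOn x (Set.Iio n) ∧ MonotoneOn u (Set.Iio n) ∧
        (∀ r, v ≤ r ↔ 0 ≤ r ∧ Reach x u r k n) ∧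
        (∀ j < k, cs j < n ∧ τ.natArr 0 j = s (cs j)) ∧ (∀ i j, i < j → j < k → cs i < cs j) ∧
        ∀ i < n, ∃ j < k,
          (i ≤ cs j ∧ u (cs j) - u i ≤ v) ∨ (cs j ≤ i ∧ x i - x (cs j) ≤ v)) := by
  refine Run.seq (run_sortProg (κ := fun v => z (v + v)) h1 hn (by simp [hz])).frame ?_
  rintro σ₁ ⟨⟨hsort, hcov⟩, hF₁⟩
  set s := σ₁.natArr 1 with hs
  obtain ⟨hsn, hinj⟩ := lt_and_injOn_of_cover hcov
  have h11 : σ₁.natReg 1 = n := (hF₁.natReg 1 rfl).trans h1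
  refine Run.seq (run_fillProg h11 hs.symm ((hF₁.realArr 0 rfl).trans hz)).frame ?_
  rintro σ₂ ⟨⟨hx, hu, hg, hf⟩, hF₂⟩
  set x := σ₂.realArr 1 with hxdef
  set u := σ₂.realArr 2 with hudef
  have hxm : MonotoneOn x (Set.Iio n) := by
    intro i hi j hj hij
    rw [hx i hi, hx j hj]
    exact hsort i j hij hj
  have hum : MonotoneOn u (Set.Iio n) := by
    intro i hi j hj hij
    rw [hu i hi, hu j hj]
    exact neg_le_neg (hanti _ (hsn i hi) _ (hsn j hj) (hsort i j hij hj))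
  have h21 : σ₂.natReg 1 = n := (hF₂.natReg 1 rfl).trans h11
  have h22 : σ₂.natReg 2 = k := (hF₂.natReg 2 rfl).trans ((hF₁.natReg 2 rfl).trans h2)
  refine Run.seq (run_radiusProg h21 hn h22 hk rfl rfl hxm hum hg hf).frame ?_
  rintro σ₃ ⟨hcost, hF₃⟩
  have hv := hcost n le_rfl
  obtain ⟨hv0, hreach⟩ := (hv _).1 le_rfl
  refine (run_greedyProg (hF₃.realArr 1 rfl) (hF₃.realArr 2 rfl) rfl
    ((hF₃.natArr 1 rfl).trans (hF₂.natArr 1 rfl)) ((hF₃.natReg 1 rfl).trans h21)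
    ((hF₃.natReg 2 rfl).trans h22) hkn hxm hum hv0 hreach).mono le_rfl ?_
  rintro τ ⟨cs, hcs, hlt, hcover⟩
  exact ⟨s, cs, x, u, _, hsn, hinj, hcov, hx, hu, hxm, hum, hv, hcs, hlt, hcover⟩

theorem run_pruningProg_two {n k : ℕ} {A : Finset (Fin 2 → ℝ)} (hA : IsParetoSet A) (hn : 0 < n)
    (hk : 0 < k) (hkn : k ≤ n) (a : Fin n ≃ A) {σ : Store}
    (hσ : HoldsInput (fun i => (a i : Fin 2 → ℝ)) k σ) :
    Run (.seq sortProg (.seq fillProg (.seq radiusProg greedyProg))) σ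
      (160 * n * Nat.clog 2 n + 40 * n + (50 * n + 20 + (k * (240 * n + 30) + 8 +
        (k * (60 * n + 50) + 14)))) (fun τ => ∃ S,
      HoldsOutput (fun i => (a i : Fin 2 → ℝ)) k S τ ∧ IsOptimalSlate A k S) := by
  classical
  obtain ⟨-, h1, h2, hz⟩ := hσ
  set z := σ.realArr 0 with hzdef
  have hz0 : ∀ i (h : i < n), z (i + i) = (a ⟨i, h⟩ : Fin 2 → ℝ) 0 := fun i h => by
    simpa [two_mul] using hz ⟨i, h⟩ 0
  have hz1 : ∀ i (h : i < n), z (i + i + 1) = (a ⟨i, h⟩ : Fin 2 → ℝ) 1 := fun i h => by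
    simpa [two_mul] using hz ⟨i, h⟩ 1
  refine (run_twoObjectives hn hk hkn h1 h2 hzdef.symm ?_).mono le_rfl ?_
  · intro i hi j hj hij
    rw [hz0 i hi, hz0 j hj] at hij
    rw [hz1 i hi, hz1 j hj]
    exact hA.anti (a _).2 (a _).2 hij
  rintro τ ⟨s, cs, x, u, v, hsn, hinj, hcov, hx, hu, hxm, hum, hv, hcs, hlt, hcover⟩
  -- the sorted sequence of points
  let q : ℕ → Fin 2 → ℝ := fun i => if h : s i < n then a ⟨s i, h⟩ else 0
  have hq : ∀ i (h : i < n), q i = a ⟨s i, hsn i h⟩ := fun i h => dif_pos (hsn i h)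
  have hqA : ∀ i < n, q i ∈ A := fun i h => by rw [hq i h]; exact (a _).2
  have hqx : ∀ i < n, q i 0 = x i := fun i h => by rw [hq i h, hx i h, hz0 _ (hsn i h)]
  have hqu : ∀ i < n, q i 1 = -u i := fun i h => by
    rw [hq i h, hu i h, hz1 _ (hsn i h), neg_neg]
  have hqinj : Set.InjOn q (Set.Iio n) := by
    intro i hi j hj hij
    rw [hq i hi, hq j hj] at hij
    have := a.injective (Subtype.ext hij)
    exact hinj hi hj (Fin.mk.inj this)
  have hqsurj : ∀ p ∈ A, ∃ i < n, q i = p := by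
    intro p hp
    obtain ⟨⟨w, hw⟩, hwp⟩ := a.surjective ⟨p, hp⟩
    obtain ⟨i, hi, rfl⟩ := hcov w hw
    exact ⟨i, hi, by rw [hq i hi, hwp]⟩
  have hdle : ∀ i j, i ≤ j → j < n → directedDist (q i) (q j) = u j - u i := by
    intro i j hij hj
    have hi : i < n := by omega
    rw [directedDist_of_le hA (hqA i hi) (hqA j hj), hqu i hi, hqu j hj]
    · ring
    · rw [hqx i hi, hqx j hj]
      exact hxm hi hj hij
  have hdge : ∀ i j, j ≤ i → i < n → directedDist (q i) (q j) = x i - x j := by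
    intro i j hij hi
    have hj : j < n := by omega
    rw [directedDist_of_ge hA (hqA i hi) (hqA j hj), hqx i hi, hqx j hj]
    rw [hqx i hi, hqx j hj]
    exact hxm hj hi hij
  have hAne : A.Nonempty := ⟨q 0, hqA 0 hn⟩
  let S : Finset (Fin 2 → ℝ) := Finset.univ.image fun j : Fin k => q (cs j)
  have hmem : ∀ j < k, q (cs j) ∈ S := fun j hj =>
    Finset.mem_image.2 ⟨⟨j, hj⟩, Finset.mem_univ _, rfl⟩
  have hcsinj : Function.Injective fun j : Fin k => q (cs j) := by
    intro i j hij
    have h3 := hqinj (hcs i i.2).1 (hcs j j.2).1 hij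
    rcases lt_trichotomy i j with h | h | h
    · exact absurd h3 (hlt i j h j.2).ne
    · exact h
    · exact absurd h3 (hlt j i h i.2).ne'
  refine ⟨S, ⟨fun j => ⟨s (cs j), hsn _ (hcs j j.2).1⟩, fun j => (hcs j j.2).2, ?_⟩, ?_, ?_, ?_⟩
  · exact Finset.image_congr fun j _ => hq _ (hcs j j.2).1
  · intro p hp
    obtain ⟨j, -, rfl⟩ := Finset.mem_image.1 hp
    exact hqA _ (hcs j j.2).1
  · rw [Finset.card_image_of_injective _ hcsinj, Finset.card_univ, Fintype.card_fin]
  · intro S' hS'A hS'k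
    have hS'ne : S'.Nonempty := Finset.card_pos.1 (by omega)
    have hSle : directedCoverage S A ≤ v := by
      refine (directedCoverage_le_iff ⟨_, hmem 0 hk⟩ hAne v).2 fun p hp => ?_
      obtain ⟨i, hi, rfl⟩ := hqsurj p hp
      obtain ⟨j, hj, ⟨h3, h4⟩ | ⟨h3, h4⟩⟩ := hcover i hi
      · exact ⟨_, hmem j hj, by rwa [hdle i _ h3 (hcs j hj).1]⟩
      · exact ⟨_, hmem j hj, by rwa [hdge i _ h3 hi]⟩
    refine hSle.trans ((hv _).2 ?_)
    have hcov' := (directedCoverage_le_iff hS'ne hAne _).1 (le_refl (directedCoverage S' A))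
    have hr0 : 0 ≤ directedCoverage S' A := by
      obtain ⟨t, -, ht⟩ := hcov' _ (hqA 0 hn)
      exact (directedDist_nonneg _ _).trans ht
    refine ⟨hr0, reach_of_cover hxm hum hr0 (T := (Finset.range n).filter fun i => q i ∈ S')
      ?_ ?_ le_rfl ?_⟩
    · rw [← hS'k]
      refine Finset.card_le_card_of_injOn q ?_ ?_
      · intro i hi
        exact (Finset.mem_filter.1 hi).2
      · intro i hi j hj hij
        exact hqinj (Finset.mem_range.1 (Finset.mem_filter.1 hi).1)
          (Finset.mem_range.1 (Finset.mem_filter.1 hj).1) hij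
    · intro t ht
      exact Finset.mem_range.1 (Finset.mem_filter.1 ht).1
    · intro j hj
      obtain ⟨p, hp, hd⟩ := hcov' _ (hqA j hj)
      obtain ⟨t, ht, rfl⟩ := hqsurj p (hS'A hp)
      refine ⟨t, Finset.mem_filter.2 ⟨Finset.mem_range.2 ht, hp⟩, ?_⟩
      rcases le_total j t with h | h
      · exact Or.inl ⟨h, by rwa [← hdle j t h ht]⟩
      · exact Or.inr ⟨h, by rwa [← hdge j t h hj]⟩

theorem clog_two_le {n : ℕ} (hn : 1 ≤ n) : (Nat.clog 2 n : ℝ) ≤ 1 + 2 * Real.log n := by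
  rcases hn.eq_or_lt with rfl | h
  · simp
  · have h1 : 2 ^ (Nat.clog 2 n).pred < n := Nat.pow_pred_clog_lt_self one_lt_two h
    have h2 : ((Nat.clog 2 n).pred : ℝ) * Real.log 2 ≤ Real.log n := by
      rw [← Real.log_pow]
      exact Real.log_le_log (by positivity) (by exact_mod_cast h1.le)
    have h3 : (Nat.clog 2 n : ℝ) ≤ (Nat.clog 2 n).pred + 1 := by
      exact_mod_cast Nat.le_succ_of_pred_le le_rfl
    have h4 : (0 : ℝ) ≤ ((Nat.clog 2 n).pred : ℝ) := Nat.cast_nonneg _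
    have h5 := Real.log_two_gt_d9
    nlinarith

/-- The bounds for the phases add up to the claimed running time.  The summand `4` is the test for a
single point; linear terms are absorbed by `n * k`, since `1 ≤ n` and `1 ≤ k`. -/
theorem steps_le {n k t : ℕ} (hn : 1 ≤ n) (hk : 1 ≤ k)
    (ht : t ≤ 4 + (160 * n * Nat.clog 2 n + 40 * n + (50 * n + 20 + (k * (240 * n + 30) + 8 +
        (k * (60 * n + 50) + 14))))) :
    (t : ℝ) ≤ 700 * ((n : ℝ) * k + n * Real.log n) := by
  have h1 : n ≤ n * k := Nat.le_mul_of_pos_right n hk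
  have h2 : k ≤ n * k := Nat.le_mul_of_pos_left k hn
  have h3 : t ≤ 160 * (n * Nat.clog 2 n) + 540 * (n * k) := by
    have e1 : k * (240 * n + 30) = 240 * (n * k) + 30 * k := by ring
    have e2 : k * (60 * n + 50) = 60 * (n * k) + 50 * k := by ring
    have e3 : 160 * n * Nat.clog 2 n = 160 * (n * Nat.clog 2 n) := by ring
    rw [e1, e2, e3] at ht
    omega
  have h4 : (t : ℝ) ≤ 160 * (n * Nat.clog 2 n) + 540 * (n * k) := by exact_mod_cast h3
  have h5 : (n : ℝ) * Nat.clog 2 n ≤ n * (1 + 2 * Real.log n) :=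
    mul_le_mul_of_nonneg_left (clog_two_le hn) (Nat.cast_nonneg n)
  have h6 : (n : ℝ) ≤ n * k := by exact_mod_cast h1
  have h7 : (0 : ℝ) ≤ n * Real.log n :=
    mul_nonneg (Nat.cast_nonneg n) (Real.log_natCast_nonneg n)
  linarith

theorem run_pruningProg_one {d k : ℕ} {A : Finset (Fin d → ℝ)} (hA : A.card = 1) (hk : k = 1)
    (a : Fin A.card ≃ A) (σ : Store) :
    Run (.putNat 0 (.const 0) (.const 0)) σ 3 (fun τ => ∃ S,
      HoldsOutput (fun i => (a i : Fin d → ℝ)) k S τ ∧ IsOptimalSlate A k S) := by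
  classical
  subst hk
  let i₀ : Fin A.card := ⟨0, by omega⟩
  have hS : {(a i₀ : Fin d → ℝ)} = A :=
    Finset.eq_of_subset_of_card_le (Finset.singleton_subset_iff.2 (a i₀).2) (by simp [hA])
  refine .of_wp le_rfl ⟨A, ⟨fun _ => i₀, fun j => ?_, ?_⟩, subset_rfl, hA, fun S' hS' hk => ?_⟩
  · simp [NatExpr.eval, i₀]
  · refine hS.symm.trans ?_
    simp
  · rw [Finset.eq_of_subset_of_card_le hS' (by omega)]

end ParetoPruning

theorem mainTheorem7 :
    ∃ (P : ParetoPruning.Prog) (C : ℝ),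
      ∀ (d : ℕ), d ≤ 2 →
      ∀ (A : Finset (Fin d → ℝ)), ParetoPruning.IsParetoSet A →
      ∀ (k : ℕ), 1 ≤ k → k ≤ A.card →
      ∀ (a : Fin A.card ≃ A) (σ : ParetoPruning.Store),
        ParetoPruning.HoldsInput (fun i => (a i : Fin d → ℝ)) k σ →
        ∃ (t : ℕ) (τ : ParetoPruning.Store) (S : Finset (Fin d → ℝ)),
          ParetoPruning.Exec P σ t τ ∧
          (t : ℝ) ≤ C * ((A.card : ℝ) * (k : ℝ) + (A.card : ℝ) * Real.log (A.card : ℝ)) ∧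
          ParetoPruning.HoldsOutput (fun i => (a i : Fin d → ℝ)) k S τ ∧
          ParetoPruning.IsOptimalSlate A k S := by
  refine ⟨ParetoPruning.pruningProg, 700, fun d hd A hA k hk hkA a σ hσ => ?_⟩
  have h1 : σ.natReg 1 = A.card := hσ.2.1
  by_cases hcard : A.card ≤ 1
  · obtain ⟨t, τ, he, ht, S, hout, hopt⟩ :=
      ParetoPruning.run_pruningProg_one (k := k) (by omega) (by omega) a σ
    exact ⟨4 + t, τ, S, .iteTrue (h1.trans_le hcard) he,
      ParetoPruning.steps_le (by omega) hk (by omega), hout, hopt⟩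
  · have hd2 : d = 2 := by
      by_contra hne
      exact hcard (hA.card_le_one (by omega))
    subst hd2
    obtain ⟨t, τ, he, ht, S, hout, hopt⟩ :=
      ParetoPruning.run_pruningProg_two hA (by omega) hk hkA a hσ
    refine ⟨4 + t, τ, S, .iteFalse (fun hb => hcard ?_) he,
      ParetoPruning.steps_le (by omega) hk (by omega), hout, hopt⟩
    exact h1.symm.trans_le hb
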